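/- Let $\lambda$ be a regular uncountable cardinal and let $\kappa$ be a cardinal with $\kappa=\lambda^+=2^\lambda$. Suppose that $\square_\lambda$ and $\diamondsuit(\lambda)$ both hold. Then there exists a streamlined, normal, prolific, full $\kappa$-Souslin tree. Here the notions are as follows. **Square.** For a set $C$ of ordinals, $\operatorname{acc}(C)=\{\alpha\in C\mid \sup(C\cap\alpha)=\alpha>0\}$. The principle $\square_\lambda$ asserts that there is a sequence $\langle C_\alpha\mid\alpha<\lambda^+\rangle$ such that for every $\alpha<\lambda^+$: $C_\alpha$ is a closed subset of $\alpha$ with $\sup(C_\alpha)=\sup(\alpha)$ and $\operatorname{otp}(C_\alpha)\le\lambda$, and for every $\beta\in\operatorname{acc}(C_\alpha)$ there is an ordinal $\gamma$ with $C_\beta=C_\alpha\cap\gamma$. **Diamond.** The principle $\diamondsuit(\lambda)$ asserts that there is a sequence $\langle f_\beta:\beta\to\lambda\mid\beta<\lambda\rangle$ of functions such that for every function $f:\lambda\to\lambda$, the set $\{\beta<\lambda\mid f\restriction\beta=f_\beta\}$ is stationary in $\lambda$. **Trees.** A poset $(T,<_T)$ is a *$\kappa$-tree* iff for every $x\in T$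 the set $\{y\in T\mid y<_Tx\}$ is well-ordered by $<_T$ (its order type is the height of $x$), for every $\alpha<\kappa$ the set $T_\alpha$ of nodes of height $\alpha$ is nonempty and of size less than $\kappa$, and $T_\kappa=\emptyset$. An *$\alpha$-branch* is a linearly ordered $B\subseteq T$ whose set of heights is exactly $\alpha$; it is *vanishing* iff it has no upper bound in $T$. A $\kappa$-tree is - *full* iff for every limit ordinal $\alpha<\kappa$ there is at most one vanishing $\alpha$-branch; - *normal* iff for all $\alpha<\beta<\kappa$ and $x\in T_\alpha$ there is $y\in T_\beta$ with $x<_Ty$; - *$\kappa$-Souslin* iff it has no $\kappa$-branches and no antichains (sets of pairwise incomparable nodes) of size $\kappa$. Let $H_\kappa$ denote the collection of all sets of hereditary cardinality less than $\kappa$. A *streamlined $\kappa$-tree* is a set $T$ of functions from ordinals less than $\kappa$ to $H_\kappa$ that is closed under restrictions to ordinals and such that for every $\alpha<\kappa$, the set of elements of $T$ with domain $\alpha$ is nonempty and has size less than $\kappa$; it is identified with the poset $(T,\subseteq)$, whose $\alpha$-th level $T_\alpha$ is this set. It is *prolific* iff for all $\alpha<\kappa$ and $t\in T_\alpha$, $t{}^\smallfrown\langle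 i\rangle\in T$ for every ordinal $i<\max\{\omega,\alpha\}$. -/

import Mathlib

universe u v

noncomputable section

namespace FullSouslin

open Cardinal Ordinal

/-! ### Square and diamond -/

/-- `acc(C)`: the set of accumulation points of `C` that belong to `C`. -/
def acc (C : Set Ordinal.{u}) : Set Ordinal.{u} :=
  {α | α ∈ C ∧ sSup (C ∩ Set.Iio α) = α ∧ 0 < α}

/-- `C` is a subset of the ordinal `α` that is closed in (the order topology of) `α`. -/
def IsClosedSubset (C : Set Ordinal.{u}) (α : Ordinal.{u}) : Prop :=
  C ⊆ Set.Iio α ∧ ∀ β < α, 0 < β → sSup (C ∩ Set.Iio β) = β → β ∈ C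

/-- `C` (restricted to the ordinals below `κ`) is a `C`-sequence over `κ`. -/
def IsCSequence (κ : Cardinal.{u}) (C : Ordinal.{u} → Set Ordinal.{u}) : Prop :=
  ∀ α < κ.ord, IsClosedSubset (C α) α ∧ sSup (C α) = sSup (Set.Iio α)

/-- The `C`-sequence is `lam`-bounded: `otp(C_α) ≤ lam` for all `α < κ`. -/
def IsBoundedCSequence (κ lam : Cardinal.{u}) (C : Ordinal.{u} → Set Ordinal.{u}) : Prop :=
  ∀ α < κ.ord, Ordinal.type (fun a b : C α => a < b) ≤ Ordinal.lift.{u + 1, u} lam.ord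

/-- `D ⊑ C`: `D` is an initial segment of `C`. -/
def IsInitialPart (D C : Set Ordinal.{u}) : Prop :=
  ∃ β : Ordinal.{u}, D = C ∩ Set.Iio β

/-- The `C`-sequence is `⊑`-coherent. -/
def IsCoherentCSequence (κ : Cardinal.{u}) (C : Ordinal.{u} → Set Ordinal.{u}) : Prop :=
  ∀ α < κ.ord, ∀ β < α, β ∈ acc (C α) → IsInitialPart (C β) (C α)

/-- Jensen's square principle at `lam`: there is a coherent `lam`-bounded `C`-sequence over the
successor cardinal of `lam`. -/
def Square (lam : Cardinal.{u}) : Prop :=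
  ∃ C : Ordinal.{u} → Set Ordinal.{u}, IsCSequence (Order.succ lam) C ∧
    IsBoundedCSequence (Order.succ lam) lam C ∧ IsCoherentCSequence (Order.succ lam) C

/-- Jensen's diamond principle at `lam`: there is a sequence `⟨F_β | β < lam⟩` of functions
`F_β : β → lam` such that for every `f : lam → lam`, the set of `β < lam` with `f ↾ β = F_β` is
stationary in `lam`. -/
def Diamond (lam : Cardinal.{u}) : Prop :=
  ∃ F : (β : Set.Iio lam.ord) → Set.Iio β → Set.Iio lam.ord,
    ∀ f : Set.Iio lam.ord → Set.Iio lam.ord,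
      IsStationary {β : Set.Iio lam.ord | ∀ γ : Set.Iio β, f γ = F β γ}

/-! ### Abstract trees -/

section Abstract

variable (P : Type v) [PartialOrder P]

variable {P} in
/-- The set of predecessors of `x` has order type `α`, i.e. `x` has height `α`. -/
def HasHeight (x : P) (α : Ordinal.{u}) : Prop :=
  Nonempty (Set.Iio x ≃o Set.Iio α)

/-- The `α`-th level of the tree. -/
def treeLevel (α : Ordinal.{u}) : Set P :=
  {x | HasHeight x α}

/-- `κ`-trees: predecessors of nodes are well-ordered, all levels below `κ` are nonempty and of
size `< κ`, and the level `κ` is empty. -/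
structure IsKTree (κ : Cardinal.{u}) : Prop where
  wellOrdered : ∀ x : P, IsWellOrder (Set.Iio x) (fun a b => a < b)
  level_nonempty : ∀ α < κ.ord, (treeLevel P α).Nonempty
  level_card : ∀ α < κ.ord, Cardinal.lift.{u} #(treeLevel P α) < Cardinal.lift.{v} κ
  level_top : treeLevel P κ.ord = ∅

variable {P} in
/-- `B` is an `α`-branch: it is linearly ordered, and the set of heights of its elements is
exactly `α = {β | β < α}`. -/
def IsBranch (α : Ordinal.{u}) (B : Set P) : Prop :=
  IsChain (· ≤ ·) B ∧ (∀ x ∈ B, ∃ β < α, HasHeight x β) ∧ ∀ β < α, ∃ x ∈ B, HasHeight x β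

variable {P} in
/-- A set of nodes is vanishing if it has no upper bound in the tree. -/
def IsVanishing (B : Set P) : Prop :=
  ¬ ∃ y : P, ∀ x ∈ B, x ≤ y

/-- Full: for every limit `α < κ` there is at most one vanishing `α`-branch. -/
def IsFull (κ : Cardinal.{u}) : Prop :=
  ∀ α < κ.ord, Order.IsSuccLimit α → ∀ B B' : Set P,
    IsBranch α B → IsVanishing B → IsBranch α B' → IsVanishing B' → B = B'

/-- Normal: every node has extensions at all higher levels below `κ`. -/
def IsNormalTree (κ : Cardinal.{u}) : Prop :=
  ∀ α β : Ordinal.{u}, α < β → β < κ.ord → ∀ x ∈ treeLevel P α, ∃ y ∈ treeLevel P β, x < y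

/-- `κ`-Souslin tree: a `κ`-tree with no `κ`-branches and no antichains (sets of pairwise
incomparable nodes) of size `κ`. -/
structure IsSouslinTree (κ : Cardinal.{u}) : Prop where
  isKTree : IsKTree P κ
  no_branch : ¬ ∃ B : Set P, IsBranch κ.ord B
  no_antichain : ¬ ∃ A : Set P, IsAntichain (· ≤ ·) A ∧
    Cardinal.lift.{u} #A = Cardinal.lift.{v} κ

end Abstract

/-! ### Transfinite sequences and streamlined trees -/

/-- `H_κ`: the sets whose transitive closure (the least transitive superset) has cardinality less
than `κ`. -/
def hered (κ : Cardinal.{u}) : Set ZFSet.{u} :=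
  {x | ∃ y : ZFSet.{u}, y.IsTransitive ∧ x ⊆ y ∧ y.card < κ}

/-- A transfinite sequence of sets: a function from an ordinal to the universe of sets. -/
structure OrdSeq : Type (u + 1) where
  length : Ordinal.{u}
  val : Set.Iio length → ZFSet.{u}

namespace OrdSeq

/-- `t ≤ s` is the inclusion `t ⊆ s` of functions, that is, `s` end-extends `t`. -/
instance : PartialOrder OrdSeq.{u} where
  le t s := ∃ h : t.length ≤ s.length, ∀ i : Set.Iio t.length, t.val i = s.val ⟨i, i.2.trans_le h⟩
  le_refl _ := ⟨le_rfl, fun _ => rfl⟩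
  le_trans _ _ _ := fun ⟨h, e⟩ ⟨h', e'⟩ => ⟨h.trans h', fun i => (e i).trans (e' _)⟩
  le_antisymm := by
    rintro ⟨a, f⟩ ⟨b, g⟩ ⟨h, e⟩ ⟨h', e'⟩
    obtain rfl : a = b := le_antisymm h h'
    congr
    exact funext fun i => e i

/-- The restriction `t ↾ α`. -/
def restrict (t : OrdSeq.{u}) (α : Ordinal.{u}) : OrdSeq.{u} where
  length := min t.length α
  val i := t.val ⟨i, Set.Iio_subset_Iio (min_le_left _ _) i.2⟩

open Classical in
/-- The sequence `t ⌢ ⟨x⟩`. -/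
def concat (t : OrdSeq.{u}) (x : ZFSet.{u}) : OrdSeq.{u} where
  length := Order.succ t.length
  val i := if h : (i : Ordinal.{u}) < t.length then t.val ⟨i, h⟩ else x

end OrdSeq

/-- The set of all functions from an ordinal less than `κ` to `H_κ`. -/
def seqsBelow (κ : Cardinal.{u}) : Set OrdSeq.{u} :=
  {t | t.length < κ.ord ∧ ∀ i, t.val i ∈ hered κ}

/-- `T_α`: the elements of `T` with domain `α`. -/
def seqLevel (T : Set OrdSeq.{u}) (α : Ordinal.{u}) : Set OrdSeq.{u} :=
  {t | t ∈ T ∧ t.length = α}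

/-- Streamlined `κ`-trees. Such a `T` is viewed as a poset by the order induced from `OrdSeq`. -/
structure IsStreamlined (κ : Cardinal.{u}) (T : Set OrdSeq.{u}) : Prop where
  subset : T ⊆ seqsBelow κ
  restrict_mem : ∀ t ∈ T, ∀ α < κ.ord, t.restrict α ∈ T
  level_nonempty : ∀ α < κ.ord, (seqLevel T α).Nonempty
  level_card : ∀ α < κ.ord, #(seqLevel T α) < Cardinal.lift.{u + 1} κ

/-- Prolific: `t ⌢ ⟨i⟩ ∈ T` for all `α < κ`, `t ∈ T_α` and `i < max {ω, α}`, where the ordinal `i`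
is taken as a von Neumann ordinal. -/
def IsProlific (κ : Cardinal.{u}) (T : Set OrdSeq.{u}) : Prop :=
  ∀ α < κ.ord, ∀ t ∈ seqLevel T α, ∀ i < max ω α, t.concat i.toZFSet ∈ T

end FullSouslin

end

noncomputable section

open Cardinal Ordinal

namespace FullSouslin

/-! ### Bounds below a regular cardinal -/

/-! Square yields a coherent ladder system `D` below `κ`, with ladders of type at most `lam` at
limit heights, whose limit points avoid a stationary set `S` of ordinals of cofinality `ω`
(`exists_isLadder`). A node of height `η < α` has a canonical extension to `α`: climb the rungs of
`D α` above `η` and take unions at limits. By coherence, the part of the climb up to a limit point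
of `D α` is itself a canonical extension.

Fullness is built in. A limit level admits every branch except possibly the single one guessed by
diamond through codes along `D α`, and admits even that one if it is canonical. Levels still have
size at most `lam` (`mk_lev_le`). If `D α` has type below `lam`, a branch is determined by a short
sequence of codes, and the diamond sequence lists all such sequences. If the type is `lam`, nothing
is omitted, but every branch is canonical (`exists_ext_eq`): otherwise diamond would guess it at a
limit point `δ` of `D α` by which canonical extensions from rungs below `δ` have departed from it;
yet its restriction to `δ` is in the tree although guessed, hence canonical.

Antichains are sealed by jumps: at a rung in `S` the canonical step tries to pass through an element
of a predicted family. Limit points avoid `S`, so walking down from `β` shows that canonical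
extensions to `β` pass through a jump at a given `γ ∈ S` (`exists_restr_jmp_eq`), provided that
jumps met on the walk do not detour below `γ`. The parameter `n` ensures this: a jump respects the
canonical path until `n` rungs of its ladder are passed, and since walks are finite, a large enough
`n` works for given `γ` and `β`. At a height `α` with ladder of type `lam`, one `n` serves cofinally
many `γ < α`; as all nodes there are canonical, they all meet the family.

Finally `κ = 2 ^ lam` supplies `lam` candidate predictions at each height in `S`
(`exists_prediction`). As in Kunen's argument, if the tree for every candidate `i` and every `n` had
a counterexample, predicting all counterexamples simultaneously would give a contradiction
(`exists_sealed`). -/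

theorem exists_bound {c : Cardinal.{u}} (hc : c.IsRegular) {θ : Ordinal.{u}} (hθ : θ < c.ord)
    (h : Ordinal.{u} → Ordinal.{u}) (hh : ∀ ξ < θ, h ξ < c.ord) :
    ∃ υ < c.ord, ∀ ξ < θ, h ξ < υ := by
  refine ⟨⨆ a : θ.ToType, Order.succ (h (Ordinal.ToType.mk.symm a)), ?_, ?_⟩
  · apply Ordinal.iSup_lt_of_lt_cof
    · rwa [hc.cof_ord, Cardinal.mk_toType, ← Cardinal.lt_ord]
    · intro a
      exact (Cardinal.isSuccLimit_ord hc.1).succ_lt (hh _ (Ordinal.ToType.mk.symm a).2)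
  · intro ξ hξ
    have := Ordinal.le_iSup (fun a : θ.ToType => Order.succ (h (Ordinal.ToType.mk.symm a)))
      (Ordinal.ToType.mk ⟨ξ, hξ⟩)
    simp only [OrderIso.symm_apply_apply] at this
    exact (Order.lt_succ _).trans_le this

theorem exists_bound_nat {c : Cardinal.{u}} (hc : c.IsRegular) (hu : ℵ₀ < c)
    (h : ℕ → Ordinal.{u}) (hh : ∀ n, h n < c.ord) : ∃ υ < c.ord, ∀ n, h n < υ := by
  classical
  obtain ⟨υ, h1, h2⟩ := exists_bound hc (θ := ω)
    (by rw [← Cardinal.ord_aleph0]; exact Cardinal.ord_lt_ord.2 hu)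
    (fun ξ => if hx : ∃ n : ℕ, (n : Ordinal) = ξ then h hx.choose else 0) (by
      intro ξ hξ
      split_ifs
      · exact hh _
      · exact hc.ord_pos)
  refine ⟨υ, h1, fun n => ?_⟩
  have := h2 n (Ordinal.natCast_lt_omega0 n)
  have hx : ∃ m : ℕ, (m : Ordinal.{u}) = n := ⟨n, rfl⟩
  rw [dif_pos hx] at this
  rwa [Nat.cast_injective (R := Ordinal) hx.choose_spec] at this

/-! ### Ranks in sets of ordinals -/

open Classical in
/-- The order type of `X ∩ c`. -/
def rk (X : Set Ordinal.{u}) (c : Ordinal.{u}) : Ordinal.{u} :=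
  ⨆ a : Set.Iio c, if a.1 ∈ X then Order.succ (rk X a.1) else 0
termination_by c
decreasing_by exact a.2

theorem rk_lt {X : Set Ordinal.{u}} {a c : Ordinal.{u}} (ha : a ∈ X) (hac : a < c) :
    rk X a < rk X c := by
  rw [rk.eq_1 X c]
  have := Ordinal.le_iSup (fun a : Set.Iio c => open Classical in
    if a.1 ∈ X then Order.succ (rk X a.1) else 0) ⟨a, hac⟩
  simp only [ha, if_true] at this
  exact (Order.lt_succ _).trans_le this

theorem rk_le {X : Set Ordinal.{u}} {c ξ : Ordinal.{u}} (h : ∀ a ∈ X, a < c → rk X a < ξ) :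
    rk X c ≤ ξ := by
  rw [rk.eq_1 X c]
  refine Ordinal.iSup_le fun a => ?_
  split_ifs with ha
  · exact Order.succ_le_of_lt (h _ ha a.2)
  · exact zero_le

/-- A rank that is skipped at `c` would bound `rk X c`, because by induction it is not skipped below
any larger-ranked element. -/
theorem exists_rk_eq {X : Set Ordinal.{u}} {c ξ : Ordinal.{u}} (h : ξ < rk X c) :
    ∃ a ∈ X, a < c ∧ rk X a = ξ := by
  induction c using WellFoundedLT.induction with
  | ind c ih =>
    by_contra! hne
    have : rk X c ≤ ξ := by
      refine rk_le fun a ha hac => ?_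
      by_contra! hle
      rcases hle.eq_or_lt with h1 | h1
      · exact hne a ha hac h1.symm
      · obtain ⟨b, hb, hba, hb'⟩ := ih a hac h1
        exact hne b hb (hba.trans hac) hb'
    exact absurd h this.not_gt

theorem rk_mono (X : Set Ordinal.{u}) {a c : Ordinal.{u}} (hac : a ≤ c) : rk X a ≤ rk X c :=
  rk_le fun _ hb hba => rk_lt hb (hba.trans_le hac)

theorem rk_subset {X Y : Set Ordinal.{u}} (h : X ⊆ Y) (c : Ordinal.{u}) : rk X c ≤ rk Y c := by
  induction c using WellFoundedLT.induction with
  | ind c ih => exact rk_le fun a ha hac => (ih a hac).trans_lt (rk_lt (h ha) hac)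

theorem rk_congr {X Y : Set Ordinal.{u}} {c : Ordinal.{u}} (h : ∀ a < c, a ∈ X ↔ a ∈ Y) :
    rk X c = rk Y c := by
  induction c using WellFoundedLT.induction with
  | ind c ih =>
    have key : ∀ a < c, rk X a = rk Y a := fun a ha => ih a ha fun b hb => h b (hb.trans ha)
    apply le_antisymm
    · exact rk_le fun a ha hac => by rw [key a hac]; exact rk_lt ((h a hac).1 ha) hac
    · exact rk_le fun a ha hac => by rw [← key a hac]; exact rk_lt ((h a hac).2 ha) hac

theorem lt_of_rk_lt {X : Set Ordinal.{u}} {a c : Ordinal.{u}} (h : rk X a < rk X c) : a < c := by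
  by_contra! hle
  exact absurd h (rk_mono X hle).not_gt

theorem rk_injOn {X : Set Ordinal.{u}} {a c : Ordinal.{u}} (ha : a ∈ X) (hc : c ∈ X)
    (h : rk X a = rk X c) : a = c := by
  rcases lt_trichotomy a c with h1 | h1 | h1
  · exact absurd h (rk_lt ha h1).ne
  · exact h1
  · exact absurd h (rk_lt hc h1).ne'

/-- Turns the order type bound in `Square` into a bound on `rk`. -/
theorem rk_eq_type {X : Set Ordinal.{u}} {c : Ordinal.{u}} (h : X ⊆ Set.Iio c) :
    Ordinal.type (fun a b : X => a < b) = Ordinal.lift.{u + 1, u} (rk X c) := by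
  have e : (fun a b : X => a < b) ≃r (fun a b : Set.Iio (rk X c) => a < b) := by
    refine RelIso.ofSurjective (RelEmbedding.ofMonotone
      (fun a => ⟨rk X a.1, rk_lt a.2 (h a.2)⟩) fun a b hab => rk_lt a.2 hab) ?_
    rintro ⟨ξ, hξ⟩
    obtain ⟨a, ha, -, rfl⟩ := exists_rk_eq hξ
    exact ⟨⟨a, ha⟩, rfl⟩
  rw [Ordinal.type_eq.2 ⟨e⟩]
  exact Ordinal.type_lt_Iio _

/-! ### Closure points of functions on a regular cardinal -/

/-- The transfinite iteration of `g`. -/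
def iter (g : Ordinal.{u} → Ordinal.{u}) (ξ : Ordinal.{u}) : Ordinal.{u} :=
  ⨆ a : Set.Iio ξ, Order.succ (g (iter g a.1))
termination_by ξ
decreasing_by exact a.2

theorem lt_iter (g : Ordinal.{u} → Ordinal.{u}) {a ξ : Ordinal.{u}} (h : a < ξ) :
    g (iter g a) < iter g ξ := by
  rw [iter.eq_1 g ξ]
  exact (Order.lt_succ _).trans_le
    (Ordinal.le_iSup (fun a : Set.Iio ξ => Order.succ (g (iter g a.1))) ⟨a, h⟩)

theorem exists_le_of_lt_iter {g : Ordinal.{u} → Ordinal.{u}} {β ξ : Ordinal.{u}}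
    (h : β < iter g ξ) : ∃ a < ξ, β ≤ g (iter g a) := by
  rw [iter.eq_1 g ξ] at h
  obtain ⟨a, ha⟩ := Ordinal.lt_iSup_iff.1 h
  exact ⟨a.1, a.2, Order.lt_succ_iff.1 ha⟩

theorem iter_lt {κ : Cardinal.{u}} (hκ : κ.IsRegular) {g : Ordinal.{u} → Ordinal.{u}}
    (hg : ∀ ξ < κ.ord, g ξ < κ.ord) {ξ : Ordinal.{u}} (hξ : ξ < κ.ord) : iter g ξ < κ.ord := by
  induction ξ using WellFoundedLT.induction with
  | ind ξ ih =>
    obtain ⟨υ, hυ, h⟩ := exists_bound hκ hξ (fun a => g (iter g a))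
      fun a ha => hg _ (ih a ha (ha.trans hξ))
    refine lt_of_le_of_lt ?_ hυ
    by_contra! hlt
    obtain ⟨a, ha, hle⟩ := exists_le_of_lt_iter hlt
    exact absurd (h a ha) hle.not_gt

/-- Since `g` is inflationary and dominates `h` on whole initial segments, limit stages of `iter g`
are limit ordinals closed under `h`. -/
theorem exists_dominating {κ : Cardinal.{u}} (hκ : κ.IsRegular) (h : Ordinal.{u} → Ordinal.{u})
    (hh : ∀ ξ < κ.ord, h ξ < κ.ord) :
    ∃ g : Ordinal.{u} → Ordinal.{u}, (∀ ξ < κ.ord, g ξ < κ.ord) ∧ (∀ ξ < κ.ord, ξ ≤ g ξ) ∧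
      ∀ ξ < κ.ord, ∀ ζ ≤ ξ, h ζ < g ξ := by
  have key : ∀ ξ : Ordinal.{u}, ∃ υ, ξ < κ.ord → υ < κ.ord ∧ ξ ≤ υ ∧ ∀ ζ ≤ ξ, h ζ < υ := by
    intro ξ
    by_cases hξ : ξ < κ.ord
    · obtain ⟨υ, hυ, hb⟩ := exists_bound hκ
        ((Cardinal.isSuccLimit_ord hκ.1).succ_lt hξ) h
        fun a ha => hh _ ((Order.lt_succ_iff.1 ha).trans_lt hξ)
      exact ⟨max ξ υ, fun _ => ⟨max_lt hξ hυ, le_max_left _ _,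
        fun ζ hζ => (hb ζ (Order.lt_succ_of_le hζ)).trans_le (le_max_right _ _)⟩⟩
    · exact ⟨0, fun h => absurd h hξ⟩
  choose g hg using key
  exact ⟨g, fun ξ hξ => (hg ξ hξ).1, fun ξ hξ => (hg ξ hξ).2.1, fun ξ hξ => (hg ξ hξ).2.2⟩

theorem isSuccLimit_iter {κ : Cardinal.{u}} (hκ : κ.IsRegular) {g : Ordinal.{u} → Ordinal.{u}}
    (hg : ∀ ξ < κ.ord, g ξ < κ.ord) (hg' : ∀ ξ < κ.ord, ξ ≤ g ξ) {ξ : Ordinal.{u}}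
    (hξ : ξ < κ.ord) (hlim : Order.IsSuccLimit ξ) : Order.IsSuccLimit (iter g ξ) := by
  refine ⟨fun hmin => ?_, Order.isSuccPrelimit_of_succ_lt fun β hβ => ?_⟩
  · have := lt_iter g hlim.bot_lt
    exact absurd this (by rw [hmin.eq_bot]; exact not_lt_bot)
  · obtain ⟨a, ha, hle⟩ := exists_le_of_lt_iter hβ
    have h1 := lt_iter g (Order.lt_succ a)
    have h2 := lt_iter g (hlim.succ_lt ha)
    exact (Order.succ_le_of_lt (hle.trans_lt h1)).trans_lt
      ((hg' _ (iter_lt hκ hg ((hlim.succ_lt ha).trans hξ))).trans_lt h2)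

theorem iter_closed {κ : Cardinal.{u}} (hκ : κ.IsRegular) {h g : Ordinal.{u} → Ordinal.{u}}
    (hg : ∀ ξ < κ.ord, g ξ < κ.ord)
    (hgh : ∀ ξ < κ.ord, ∀ ζ ≤ ξ, h ζ < g ξ) {ξ : Ordinal.{u}}
    (hξ : ξ < κ.ord) (hlim : Order.IsSuccLimit ξ) : ∀ β < iter g ξ, h β < iter g ξ := by
  intro β hβ
  obtain ⟨a, ha, hle⟩ := exists_le_of_lt_iter hβ
  have h1 := lt_iter g (Order.lt_succ a)
  exact (hgh _ (iter_lt hκ hg ((hlim.succ_lt ha).trans hξ)) β (hle.trans h1.le)).trans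
    (lt_iter g (hlim.succ_lt ha))

/-- `s` is a strictly increasing `ω`-sequence with supremum `δ`. -/
def IsOmegaSeq (s : ℕ → Ordinal.{u}) (δ : Ordinal.{u}) : Prop :=
  StrictMono s ∧ (∀ n, s n < δ) ∧ ∀ β < δ, ∃ n, β < s n

theorem exists_closed_omega {κ : Cardinal.{u}} (hκ : κ.IsRegular) (hu : ℵ₀ < κ)
    (h : Ordinal.{u} → Ordinal.{u}) (hh : ∀ ξ < κ.ord, h ξ < κ.ord) :
    ∃ δ < κ.ord, Order.IsSuccLimit δ ∧ (∃ s, IsOmegaSeq s δ) ∧ ∀ ξ < δ, h ξ < δ := by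
  obtain ⟨g, hg, hg', hgh⟩ := exists_dominating hκ h hh
  have hω : ω < κ.ord := by rw [← Cardinal.ord_aleph0]; exact Cardinal.ord_lt_ord.2 hu
  have hn : ∀ n : ℕ, iter g n < κ.ord := fun n =>
    iter_lt hκ hg ((Ordinal.natCast_lt_omega0 n).trans hω)
  have hlt : ∀ n : ℕ, iter g n ≤ g (iter g n) := fun n => hg' _ (hn n)
  refine ⟨iter g ω, iter_lt hκ hg hω, isSuccLimit_iter hκ hg hg' hω Ordinal.isSuccLimit_omega0,
    ⟨fun n => iter g n, fun m n hmn => ?_, fun n => ?_, fun β hβ => ?_⟩,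
    iter_closed hκ hg hgh hω Ordinal.isSuccLimit_omega0⟩
  · exact (hlt m).trans_lt (lt_iter g (by exact_mod_cast hmn))
  · exact (hlt n).trans_lt (lt_iter g (Ordinal.natCast_lt_omega0 n))
  · obtain ⟨a, ha, hle⟩ := exists_le_of_lt_iter hβ
    obtain ⟨n, rfl⟩ := Ordinal.lt_omega0.1 ha
    exact ⟨n + 1, hle.trans_lt (lt_iter g (by exact_mod_cast n.lt_succ_self))⟩

/-- The rungs are indexed by a regular uncountable cardinal, so countably many points cannot be
cofinal. -/
theorem exists_bound_of_rk_eq {lam : Cardinal.{u}} (hl : lam.IsRegular) (hu : ℵ₀ < lam)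
    {X : Set Ordinal.{u}} {δ : Ordinal.{u}} (hX : ∀ β < δ, ∃ c ∈ X, c < δ ∧ β ≤ c)
    (hr : rk X δ = lam.ord) (s : ℕ → Ordinal.{u}) (hs : ∀ n, s n < δ) :
    ∃ c ∈ X, c < δ ∧ ∀ n, s n ≤ c := by
  choose c hc using fun n => hX (s n) (hs n)
  obtain ⟨υ, hυ, hb⟩ := exists_bound_nat hl hu (fun n => rk X (c n))
    fun n => by rw [← hr]; exact rk_lt (hc n).1 (hc n).2.1
  rw [← hr] at hυ
  obtain ⟨a, ha, haδ, rfl⟩ := exists_rk_eq hυ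
  exact ⟨a, ha, haδ, fun n => (hc n).2.2.trans (lt_of_rk_lt (hb n)).le⟩

theorem rk_lt_of_omegaSeq {lam : Cardinal.{u}} (hl : lam.IsRegular) (hu : ℵ₀ < lam)
    {X : Set Ordinal.{u}} {δ : Ordinal.{u}} (hX : ∀ β < δ, ∃ c ∈ X, c < δ ∧ β ≤ c)
    (hr : rk X δ ≤ lam.ord) {s : ℕ → Ordinal.{u}} (hs : IsOmegaSeq s δ) : rk X δ < lam.ord := by
  refine lt_of_le_of_ne hr fun heq => ?_
  obtain ⟨c, -, hcδ, hb⟩ := exists_bound_of_rk_eq hl hu hX heq s hs.2.1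
  obtain ⟨n, hn⟩ := hs.2.2 c hcδ
  exact absurd (hb n) hn.not_ge

/-- The supremum of a `lam`-iteration has cofinality `lam`. A shorter ladder would place its rungs
below fewer than `lam` stages, and regularity would bound them. -/
theorem exists_closed_rk_eq {κ lam : Cardinal.{u}} (hκ : κ.IsRegular) (hl : lam.IsRegular)
    (hlk : lam < κ) (D : Ordinal.{u} → Set Ordinal.{u})
    (hD : ∀ α < κ.ord, ∀ β < α, ∃ c ∈ D α, c < α ∧ β ≤ c)
    (hr : ∀ α < κ.ord, Order.IsSuccLimit α → rk (D α) α ≤ lam.ord)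
    (h : Ordinal.{u} → Ordinal.{u}) (hh : ∀ ξ < κ.ord, h ξ < κ.ord) :
    ∃ α < κ.ord, Order.IsSuccLimit α ∧ rk (D α) α = lam.ord ∧ ∀ ξ < α, h ξ < α := by
  obtain ⟨g, hg, hg', hgh⟩ := exists_dominating hκ h hh
  have hω : lam.ord < κ.ord := Cardinal.ord_lt_ord.2 hlk
  have hlim := Cardinal.isSuccLimit_ord hl.1
  have hακ := iter_lt hκ hg hω
  have hαl := isSuccLimit_iter hκ hg hg' hω hlim
  refine ⟨iter g lam.ord, hακ, hαl, ?_, iter_closed hκ hg hgh hω hlim⟩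
  refine (hr _ hακ hαl).eq_of_not_lt fun hlt => ?_
  set α := iter g lam.ord
  have : ∀ ρ, ∃ ξ < lam.ord, ∀ c ∈ D α, c < α → rk (D α) c = ρ → c ≤ g (iter g ξ) := by
    intro ρ
    by_cases hρ : ∃ c ∈ D α, c < α ∧ rk (D α) c = ρ
    · obtain ⟨c, hc, hcα, rfl⟩ := hρ
      obtain ⟨ξ, hξ, hle⟩ := exists_le_of_lt_iter hcα
      exact ⟨ξ, hξ, fun c' hc' _ he => by rwa [rk_injOn hc' hc he]⟩
    · push Not at hρ
      exact ⟨0, hl.ord_pos, fun c hc hcα he => absurd he (hρ c hc hcα)⟩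
  choose f hf hf' using this
  obtain ⟨υ, hυ, hb⟩ := exists_bound hl hlt f fun ρ _ => hf ρ
  have hυα : iter g υ < α := (hg' _ (iter_lt hκ hg (hυ.trans hω))).trans_lt (lt_iter g hυ)
  obtain ⟨c, hc, hcα, hle⟩ := hD α hακ _ hυα
  have h1 := hf' _ c hc hcα rfl
  exact absurd (hle.trans h1) (lt_iter g (hb _ (rk_lt hc hcα))).not_ge

/-! ### Ladder systems -/

/-- `β` is a limit point of `X`. -/
def IsLim (X : Set Ordinal.{u}) (β : Ordinal.{u}) : Prop :=
  0 < β ∧ ∀ γ < β, ∃ c ∈ X, γ < c ∧ c < β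

theorem IsLim.isSuccLimit {X : Set Ordinal.{u}} {β : Ordinal.{u}} (h : IsLim X β) :
    Order.IsSuccLimit β := by
  refine ⟨fun hm => absurd h.1 (by rw [hm.eq_bot]; exact not_lt_bot),
    Order.isSuccPrelimit_of_succ_lt fun γ hγ => ?_⟩
  obtain ⟨c, -, h1, h2⟩ := h.2 γ hγ
  exact (Order.succ_le_of_lt h1).trans_lt h2

theorem IsLim.mono {X Y : Set Ordinal.{u}} {β : Ordinal.{u}} (h : IsLim X β) (hXY : X ⊆ Y) :
    IsLim Y β :=
  ⟨h.1, fun γ hγ => let ⟨c, hc, hh⟩ := h.2 γ hγ; ⟨c, hXY hc, hh⟩⟩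

theorem isLim_iff {X : Set Ordinal.{u}} {β : Ordinal.{u}} (h0 : 0 < β) :
    IsLim X β ↔ sSup (X ∩ Set.Iio β) = β := by
  have hbdd : BddAbove (X ∩ Set.Iio β) := ⟨β, fun c hc => hc.2.le⟩
  constructor
  · intro h
    apply le_antisymm (csSup_le' fun c hc => hc.2.le)
    by_contra! hlt
    obtain ⟨c, hc, h1, h2⟩ := h.2 _ hlt
    exact absurd (le_csSup hbdd ⟨hc, h2⟩) h1.not_ge
  · intro h
    refine ⟨h0, fun γ hγ => ?_⟩
    rw [← h] at hγ
    obtain ⟨c, hc, h1⟩ := exists_lt_of_lt_csSup' hγ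
    exact ⟨c, hc.1, h1, hc.2⟩

/-- A coherent ladder system below `κ` whose limit points avoid the stationary set `S`. -/
structure IsLadder (κ lam : Cardinal.{u}) (S : Set Ordinal.{u})
    (D : Ordinal.{u} → Set Ordinal.{u}) : Prop where
  below : ∀ α < κ.ord, ∀ c ∈ D α, c < α
  cofinal : ∀ α < κ.ord, ∀ β < α, ∃ c ∈ D α, β ≤ c
  closed : ∀ α < κ.ord, ∀ β < α, IsLim (D α) β → β ∈ D α
  notMem : ∀ α < κ.ord, ∀ β < α, IsLim (D α) β → β ∉ S
  coherent : ∀ α < κ.ord, ∀ β < α, IsLim (D α) β → ∀ c < β, c ∈ D β ↔ c ∈ D α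
  finite : ∀ α ∈ S, ∀ β < α, (D α ∩ Set.Iio β).Finite
  rank_le : ∀ α < κ.ord, Order.IsSuccLimit α → rk (D α) α ≤ lam.ord
  lt : ∀ α ∈ S, α < κ.ord
  omega : ∀ α ∈ S, ∃ s, IsOmegaSeq s α
  stationary : ∀ h : Ordinal.{u} → Ordinal.{u}, (∀ ξ < κ.ord, h ξ < κ.ord) →
    ∃ δ ∈ S, ∀ ξ < δ, h ξ < δ

theorem IsCSequence.exists_mem {κ : Cardinal.{u}} {C : Ordinal.{u} → Set Ordinal.{u}}
    (hC : IsCSequence κ C) {α : Ordinal.{u}} (hα : α < κ.ord) (hl : Order.IsSuccLimit α)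
    {β : Ordinal.{u}} (hβ : β < α) : ∃ c ∈ C α, β < c := by
  have h := (hC α hα).2
  have h1 : Order.succ β ≤ sSup (Set.Iio α) :=
    le_csSup ⟨α, fun c hc => le_of_lt hc⟩ (hl.succ_lt hβ)
  rw [← h] at h1
  exact exists_lt_of_lt_csSup' ((Order.lt_succ β).trans_le h1)

open Classical in
/-- The ladder system obtained from a square sequence. -/
def squareLadder (C : Ordinal.{u} → Set Ordinal.{u}) (θ : Ordinal.{u})
    (α : Ordinal.{u}) : Set Ordinal.{u} :=
  if Order.IsSuccLimit α then
    if h : rk (C α) α = θ ∧ ∃ s, IsOmegaSeq s α then Set.range h.2.choose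
    else {c ∈ C α | θ < rk (C α) α → θ < rk (C α) c}
  else {c | Order.succ c = α}

theorem not_isLim_range {s : ℕ → Ordinal.{u}} {α β : Ordinal.{u}} (hs : IsOmegaSeq s α)
    (hβ : β < α) : ¬ IsLim (Set.range s) β := by
  intro hl
  obtain ⟨n, hn⟩ := hs.2.2 β hβ
  have key : ∀ m, ∃ k, m ≤ k ∧ s k < β := by
    intro m
    induction m with
    | zero =>
      obtain ⟨_, ⟨k, rfl⟩, -, hk⟩ := hl.2 0 hl.1
      exact ⟨k, Nat.zero_le _, hk⟩
    | succ m ih =>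
      obtain ⟨k, hk, hk'⟩ := ih
      obtain ⟨_, ⟨j, rfl⟩, hj, hj'⟩ := hl.2 _ hk'
      exact ⟨j, Nat.succ_le_of_lt (hk.trans_lt (hs.1.lt_iff_lt.1 hj)), hj'⟩
  obtain ⟨k, hk, hk'⟩ := key n
  exact absurd (hn.trans_le (hs.1.monotone hk)) hk'.not_gt

theorem rk_range_le {s : ℕ → Ordinal.{u}} {α : Ordinal.{u}} (hs : IsOmegaSeq s α) :
    rk (Set.range s) α ≤ ω := by
  have key : ∀ n : ℕ, rk (Set.range s) (s n) ≤ n := by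
    intro n
    induction n using Nat.strong_induction_on with
    | _ n ih =>
      refine rk_le ?_
      rintro _ ⟨m, rfl⟩ hm
      have hmn := hs.1.lt_iff_lt.1 hm
      exact (ih m hmn).trans_lt (by exact_mod_cast hmn)
  refine rk_le ?_
  rintro _ ⟨m, rfl⟩ -
  exact (key m).trans_lt (Ordinal.natCast_lt_omega0 m)

/-- Fix a type `θ` that occurs stationarily often at cofinality `ω`, and delete the first `θ + 1`
rungs from each longer ladder. Limit points then have `C`-rank above `θ` on the longer ladders and
below `θ` on the others, so none lies in `S`. Hence the ladders at `S` can be replaced by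
`ω`-sequences without harming coherence. -/
theorem exists_isLadder {κ lam : Cardinal.{u}} (hreg : lam.IsRegular) (hunc : ℵ₀ < lam)
    (hsucc : κ = Order.succ lam) (hsq : Square lam) : ∃ S D, IsLadder κ lam S D := by
  obtain ⟨C, hC, hb, hco⟩ := hsq
  rw [← hsucc] at hC hb hco
  have hκ : κ.IsRegular := hsucc ▸ Cardinal.isRegular_succ hreg.1
  have hlk : lam < κ := hsucc ▸ Order.lt_succ lam
  have hrC : ∀ α < κ.ord, rk (C α) α ≤ lam.ord := by
    intro α hα
    have := hb α hα
    rwa [rk_eq_type (hC α hα).1.1, Ordinal.lift_le] at this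
  have hCb : ∀ α < κ.ord, ∀ c ∈ C α, c < α := fun α hα c hc => (hC α hα).1.1 hc
  have hClt : ∀ α < κ.ord, Order.IsSuccLimit α → ∀ β < α, ∃ c ∈ C α, c < α ∧ β < c := by
    intro α hα hl β hβ
    obtain ⟨c, hc, h⟩ := hC.exists_mem hα hl hβ
    exact ⟨c, hc, hCb α hα c hc, h⟩
  have hCcl : ∀ α < κ.ord, ∀ β < α, IsLim (C α) β → β ∈ C α := fun α hα β hβ h =>
    (hC α hα).1.2 β hβ h.1 ((isLim_iff h.1).1 h)
  have hCco : ∀ α < κ.ord, ∀ β < α, IsLim (C α) β → ∀ c < β, c ∈ C β ↔ c ∈ C α := by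
    intro α hα β hβ h c hc
    have hacc : β ∈ acc (C α) := ⟨hCcl α hα β hβ h, (isLim_iff h.1).1 h, h.1⟩
    obtain ⟨γ, hγ⟩ := hco α hα β hβ hacc
    rw [hγ]
    refine ⟨fun hc => hc.1, fun hc' => ⟨hc', ?_⟩⟩
    obtain ⟨d, hd, -, hcd⟩ := hClt β (hβ.trans hα) h.isSuccLimit c hc
    rw [hγ] at hd
    exact hcd.trans hd.2
  -- If every `θ` failed, the `lam` many witnesses would have a common bound `H`. A point of
  -- cofinality `ω` closed under `H` has a ladder of type below `lam`, and contradicts the witness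
  -- for that type.
  have hst : ∃ θ < lam.ord, ∀ h : Ordinal.{u} → Ordinal.{u}, (∀ ξ < κ.ord, h ξ < κ.ord) →
      ∃ δ < κ.ord, Order.IsSuccLimit δ ∧ rk (C δ) δ = θ ∧ (∃ s, IsOmegaSeq s δ) ∧
        ∀ ξ < δ, h ξ < δ := by
    by_contra! hne
    have : ∀ θ : Ordinal.{u}, ∃ h : Ordinal.{u} → Ordinal.{u}, (∀ ξ < κ.ord, h ξ < κ.ord) ∧
        (θ < lam.ord → ∀ δ < κ.ord, Order.IsSuccLimit δ → rk (C δ) δ = θ →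
          (∃ s, IsOmegaSeq s δ) → ∃ ξ < δ, δ ≤ h ξ) := by
      intro θ
      by_cases hθ : θ < lam.ord
      · obtain ⟨h, h1, h2⟩ := hne θ hθ
        exact ⟨h, h1, fun _ => h2⟩
      · exact ⟨fun _ => 0, fun _ _ => hκ.ord_pos, fun h => absurd h hθ⟩
    choose h h1 h2 using this
    have h3 : ∀ ξ : Ordinal.{u}, ∃ υ < κ.ord, ξ < κ.ord → ∀ θ < lam.ord, h θ ξ < υ := by
      intro ξ
      by_cases hξ : ξ < κ.ord
      · obtain ⟨υ, hυ, hh⟩ := exists_bound hκ (Cardinal.ord_lt_ord.2 hlk) (fun θ => h θ ξ)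
          fun θ _ => h1 θ ξ hξ
        exact ⟨υ, hυ, fun _ => hh⟩
      · exact ⟨0, hκ.ord_pos, fun h => absurd h hξ⟩
    choose H hH hH' using h3
    obtain ⟨δ, hδ, hl, ⟨s, hs⟩, hcl⟩ := exists_closed_omega hκ (hunc.trans hlk) H fun ξ _ => hH ξ
    have hrk := rk_lt_of_omegaSeq hreg hunc
      (fun β hβ => let ⟨c, hc, hc', hβc⟩ := hClt δ hδ hl β hβ; ⟨c, hc, hc', hβc.le⟩)
      (hrC δ hδ) hs
    obtain ⟨ξ, hξ, hle⟩ := h2 _ hrk δ hδ hl rfl ⟨s, hs⟩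
    exact absurd ((hH' ξ (hξ.trans hδ) _ hrk).trans (hcl ξ hξ)) hle.not_gt
  obtain ⟨θ, hθ, hst⟩ := hst
  set S : Set Ordinal.{u} := {δ | δ < κ.ord ∧ Order.IsSuccLimit δ ∧ rk (C δ) δ = θ ∧
    ∃ s, IsOmegaSeq s δ} with hS
  set D := squareLadder C θ with hD
  have hDS : ∀ α ∈ S, ∃ s, IsOmegaSeq s α ∧ D α = Set.range s := by
    rintro α ⟨-, hl, h⟩
    refine ⟨h.2.choose, h.2.choose_spec, ?_⟩
    rw [hD, squareLadder, if_pos hl, dif_pos h]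
  have hDC : ∀ α < κ.ord, Order.IsSuccLimit α → α ∉ S →
      D α = {c ∈ C α | θ < rk (C α) α → θ < rk (C α) c} := by
    intro α hα hl hn
    rw [hD, squareLadder, if_pos hl, dif_neg]
    exact fun h => hn ⟨hα, hl, h⟩
  have hDs : ∀ α, ¬ Order.IsSuccLimit α → D α = {c | Order.succ c = α} := by
    intro α hl
    rw [hD, squareLadder, if_neg hl]
  have hns : ∀ α < κ.ord, ∀ β < α, IsLim (D α) β → Order.IsSuccLimit α ∧ α ∉ S := by
    intro α hα β hβ h
    have hl : Order.IsSuccLimit α := by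
      by_contra hl
      rw [hDs α hl] at h
      obtain ⟨c, hc, -, hcβ⟩ := h.2 0 h.1
      have hc : Order.succ c = α := hc
      exact absurd (Order.succ_le_of_lt hcβ) (by rw [hc]; exact hβ.not_ge)
    refine ⟨hl, fun hS => ?_⟩
    obtain ⟨s, hs, he⟩ := hDS α hS
    rw [he] at h
    exact not_isLim_range hs hβ h
  have hsubC : ∀ α < κ.ord, ∀ β < α, IsLim (D α) β → IsLim (C α) β := by
    intro α hα β hβ h
    obtain ⟨hl, hn⟩ := hns α hα β hβ h
    rw [hDC α hα hl hn] at h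
    exact h.mono fun c hc => hc.1
  have hrkβ : ∀ α < κ.ord, ∀ β < α, IsLim (D α) β →
      rk (C β) β = rk (C α) β ∧ (θ < rk (C α) α → θ < rk (C α) β) ∧
        (¬ θ < rk (C α) α → rk (C α) β < θ) := by
    intro α hα β hβ h
    have hC' := hsubC α hα β hβ h
    refine ⟨rk_congr (hCco α hα β hβ hC'), fun hlt => ?_, fun hlt => ?_⟩
    · obtain ⟨hl, hn⟩ := hns α hα β hβ h
      rw [hDC α hα hl hn] at h
      obtain ⟨c, hc, -, hcβ⟩ := h.2 0 h.1
      exact (hc.2 hlt).trans (rk_lt hc.1 hcβ)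
    · exact (rk_lt (hCcl α hα β hβ hC') hβ).trans_le (not_lt.1 hlt)
  have hnm : ∀ α < κ.ord, ∀ β < α, IsLim (D α) β → β ∉ S := by
    intro α hα β hβ h hβS
    obtain ⟨h1, h2, h3⟩ := hrkβ α hα β hβ h
    have h4 : rk (C β) β = θ := hβS.2.2.1
    by_cases hlt : θ < rk (C α) α
    · exact absurd (h2 hlt) (by rw [← h1, h4]; exact lt_irrefl _)
    · exact absurd (h3 hlt) (by rw [← h1, h4]; exact lt_irrefl _)
  refine ⟨S, D, ?_, ?_, ?_, hnm, ?_, ?_, ?_, fun α h => h.1, fun α h => h.2.2.2, ?_⟩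
  · intro α hα c hc
    by_cases hl : Order.IsSuccLimit α
    · by_cases hn : α ∈ S
      · obtain ⟨s, hs, he⟩ := hDS α hn
        rw [he] at hc
        obtain ⟨n, rfl⟩ := hc
        exact hs.2.1 n
      · rw [hDC α hα hl hn] at hc
        exact hCb α hα c hc.1
    · rw [hDs α hl] at hc
      have hc : Order.succ c = α := hc
      exact hc ▸ Order.lt_succ c
  · intro α hα β hβ
    by_cases hl : Order.IsSuccLimit α
    · by_cases hn : α ∈ S
      · obtain ⟨s, hs, he⟩ := hDS α hn
        obtain ⟨n, hn⟩ := hs.2.2 β hβ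
        exact ⟨s n, he ▸ ⟨n, rfl⟩, hn.le⟩
      · rw [hDC α hα hl hn]
        by_cases hlt : θ < rk (C α) α
        · obtain ⟨a, ha, haα, hra⟩ := exists_rk_eq hlt
          obtain ⟨c, hc, hcα, hlc⟩ := hClt α hα hl (max a β) (max_lt haα hβ)
          refine ⟨c, ⟨hc, fun _ => ?_⟩, (le_max_right _ _).trans hlc.le⟩
          rw [← hra]
          exact rk_lt ha ((le_max_left _ _).trans_lt hlc)
        · obtain ⟨c, hc, -, hlc⟩ := hClt α hα hl β hβ
          exact ⟨c, ⟨hc, fun h => absurd h hlt⟩, hlc.le⟩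
    · rw [hDs α hl]
      have : ∃ a, Order.succ a = α := by
        by_contra! hne
        refine hl ⟨fun hm => ?_, Order.isSuccPrelimit_of_succ_ne fun a => hne a⟩
        rw [hm.eq_bot] at hβ
        exact not_lt_bot hβ
      obtain ⟨a, ha⟩ := this
      exact ⟨a, ha, Order.lt_succ_iff.1 (ha ▸ hβ)⟩
  · intro α hα β hβ h
    obtain ⟨hl, hn⟩ := hns α hα β hβ h
    have h2 := hrkβ α hα β hβ h
    rw [hDC α hα hl hn]
    exact ⟨hCcl α hα β hβ (hsubC α hα β hβ h), h2.2.1⟩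
  · intro α hα β hβ h c hc
    obtain ⟨hl, hn⟩ := hns α hα β hβ h
    obtain ⟨h1, h2, h3⟩ := hrkβ α hα β hβ h
    have hC' := hCco α hα β hβ (hsubC α hα β hβ h)
    rw [hDC α hα hl hn, hDC β (hβ.trans hα) h.isSuccLimit (hnm α hα β hβ h)]
    simp only [Set.mem_ofPred_eq]
    rw [h1, hC' c hc, rk_congr (X := C β) (Y := C α) (c := c) fun a ha => hC' a (ha.trans hc)]
    -- The ranks at `β` and `α` lead to the same decision, so both ladders are truncated or neither
    -- is.
    by_cases hlt : θ < rk (C α) α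
    · simp [hlt, h2 hlt]
    · simp [hlt, (h3 hlt).not_gt]
  · intro α hα β hβ
    obtain ⟨s, hs, he⟩ := hDS α hα
    obtain ⟨n, hn⟩ := hs.2.2 β hβ
    rw [he]
    refine ((Set.finite_Iio n).image s).subset ?_
    rintro _ ⟨⟨m, rfl⟩, hm⟩
    exact ⟨m, hs.1.lt_iff_lt.1 (lt_trans hm hn), rfl⟩
  · intro α hα hl
    by_cases hn : α ∈ S
    · obtain ⟨s, hs, he⟩ := hDS α hn
      rw [he]
      refine (rk_range_le hs).trans ?_
      rw [← Cardinal.ord_aleph0]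
      exact Cardinal.ord_le_ord.2 hunc.le
    · rw [hDC α hα hl hn]
      exact (rk_subset (fun c hc => hc.1) α).trans (hrC α hα)
  · intro h hh
    obtain ⟨δ, h1, h2, h3, h4, h5⟩ := hst h hh
    exact ⟨δ, ⟨h1, h2, h3, h4⟩, h5⟩

/-! ### Nodes as functions, and gluing along sets of ordinals -/

/-- Functions on the ordinals; a node of height `α` is a function that vanishes from `α` on. -/
abbrev Fn : Type (u + 1) := Ordinal.{u} → Ordinal.{u}

open Classical in
/-- The restriction of `f` to `β`. -/
def restr (f : Fn.{u}) (β : Ordinal.{u}) : Fn.{u} := fun ζ => if ζ < β then f ζ else 0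

theorem restr_of_lt (f : Fn.{u}) {β ζ : Ordinal.{u}} (h : ζ < β) : restr f β ζ = f ζ := if_pos h

theorem restr_of_le (f : Fn.{u}) {β ζ : Ordinal.{u}} (h : β ≤ ζ) : restr f β ζ = 0 :=
  if_neg h.not_gt

theorem restr_restr (f : Fn.{u}) {β γ : Ordinal.{u}} (h : γ ≤ β) :
    restr (restr f β) γ = restr f γ := by
  funext ζ
  by_cases hζ : ζ < γ
  · rw [restr_of_lt _ hζ, restr_of_lt _ hζ, restr_of_lt _ (hζ.trans_le h)]
  · rw [restr_of_le _ (not_lt.1 hζ), restr_of_le _ (not_lt.1 hζ)]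

theorem restr_eq_self {f : Fn.{u}} {β : Ordinal.{u}} (h : ∀ ζ, β ≤ ζ → f ζ = 0) :
    restr f β = f := by
  funext ζ
  by_cases hζ : ζ < β
  · rw [restr_of_lt _ hζ]
  · rw [restr_of_le _ (not_lt.1 hζ), h _ (not_lt.1 hζ)]

theorem restr_congr {f g : Fn.{u}} {β : Ordinal.{u}} (h : ∀ ζ < β, f ζ = g ζ) :
    restr f β = restr g β := by
  funext ζ
  by_cases hζ : ζ < β
  · rw [restr_of_lt _ hζ, restr_of_lt _ hζ, h _ hζ]
  · rw [restr_of_le _ (not_lt.1 hζ), restr_of_le _ (not_lt.1 hζ)]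

/-- The part of `X` above `η`, together with `η`. -/
def start (X : Set Ordinal.{u}) (η : Ordinal.{u}) : Set Ordinal.{u} :=
  {c | c = η ∨ (c ∈ X ∧ η < c)}

theorem self_mem_start (X : Set Ordinal.{u}) (η : Ordinal.{u}) : η ∈ start X η := Or.inl rfl

theorem le_of_mem_start {X : Set Ordinal.{u}} {η c : Ordinal.{u}} (h : c ∈ start X η) : η ≤ c :=
  h.elim (fun h => h.ge) fun h => h.2.le

/-- `p` is the immediate predecessor of `c` in `Y`. -/
def IsPred (Y : Set Ordinal.{u}) (p c : Ordinal.{u}) : Prop :=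
  p ∈ Y ∧ p < c ∧ ∀ q ∈ Y, q < c → q ≤ p

theorem sInf_isPred {Y : Set Ordinal.{u}} {p c : Ordinal.{u}} (h : IsPred Y p c) :
    sInf {p | IsPred Y p c} = p := by
  have := csInf_mem (s := {p | IsPred Y p c}) ⟨p, h⟩
  exact le_antisymm (h.2.2 _ this.1 this.2.1) (this.2.2 _ h.1 h.2.1)

open Classical in
/-- The union of the functions `φ c'` for `c' ∈ Y` below `c`. -/
def glue (Y : Set Ordinal.{u}) (c : Ordinal.{u}) (φ : Ordinal.{u} → Fn.{u}) : Fn.{u} := fun ζ =>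
  if ∃ c' ∈ Y, ζ < c' ∧ c' < c then φ (sInf {c' | c' ∈ Y ∧ ζ < c' ∧ c' < c}) ζ else 0

/-- The least point above `ζ` is only a definite choice; coherence of `φ` makes any other point give
the same value. -/
theorem glue_apply {Y : Set Ordinal.{u}} {c c' ζ : Ordinal.{u}} {φ : Ordinal.{u} → Fn.{u}}
    (hc' : c' ∈ Y) (hζ : ζ < c') (hlt : c' < c)
    (hφ : ∀ d ∈ Y, d ≤ c' → restr (φ c') d = φ d) : glue Y c φ ζ = φ c' ζ := by
  have hne : ∃ c' ∈ Y, ζ < c' ∧ c' < c := ⟨c', hc', hζ, hlt⟩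
  rw [glue, if_pos hne]
  have h1 := csInf_mem (s := {c' | c' ∈ Y ∧ ζ < c' ∧ c' < c}) hne
  have h2 : sInf {c' | c' ∈ Y ∧ ζ < c' ∧ c' < c} ≤ c' := csInf_le' ⟨hc', hζ, hlt⟩
  rw [← hφ _ h1.1 h2, restr_of_lt _ h1.2.1]

theorem restr_glue {Y : Set Ordinal.{u}} {c c' : Ordinal.{u}} {φ : Ordinal.{u} → Fn.{u}}
    (hc' : c' ∈ Y) (hlt : c' < c) (hφ : ∀ d ∈ Y, d ≤ c' → restr (φ c') d = φ d) :
    restr (glue Y c φ) c' = φ c' := by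
  rw [← hφ c' hc' le_rfl]
  exact restr_congr fun ζ hζ => glue_apply hc' hζ hlt hφ

theorem glue_of_le {Y : Set Ordinal.{u}} {c ζ : Ordinal.{u}} {φ : Ordinal.{u} → Fn.{u}}
    (h : c ≤ ζ) : glue Y c φ ζ = 0 :=
  if_neg fun ⟨_, _, h1, h2⟩ => absurd (h1.trans h2) h.not_gt

theorem glue_congr {Y Y' : Set Ordinal.{u}} {c : Ordinal.{u}} {φ φ' : Ordinal.{u} → Fn.{u}}
    (hY : ∀ d < c, d ∈ Y ↔ d ∈ Y') (hφ : ∀ d < c, φ d = φ' d) : glue Y c φ = glue Y' c φ' := by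
  funext ζ
  have hs : {c' | c' ∈ Y ∧ ζ < c' ∧ c' < c} = {c' | c' ∈ Y' ∧ ζ < c' ∧ c' < c} := by
    ext d
    constructor
    · exact fun h => ⟨(hY d h.2.2).1 h.1, h.2⟩
    · exact fun h => ⟨(hY d h.2.2).2 h.1, h.2⟩
  have hiff : (∃ c' ∈ Y, ζ < c' ∧ c' < c) ↔ ∃ c' ∈ Y', ζ < c' ∧ c' < c :=
    ⟨fun ⟨d, h⟩ => ⟨d, (hY d h.2.2).1 h.1, h.2⟩, fun ⟨d, h⟩ => ⟨d, (hY d h.2.2).2 h.1, h.2⟩⟩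
  by_cases h : ∃ c' ∈ Y, ζ < c' ∧ c' < c
  · have h1 := csInf_mem (s := {c' | c' ∈ Y ∧ ζ < c' ∧ c' < c}) h
    rw [glue, glue, if_pos h, if_pos (hiff.1 h), ← hs, hφ _ h1.2.2]
  · rw [glue, glue, if_neg h, if_neg fun h' => h (hiff.2 h')]

open Classical in
/-- The canonical path along `Y` that starts with the node `x` at height `η`, where the map
`J c` leads from nodes of smaller height to nodes of height `c`. -/
def path (J : Ordinal.{u} → Ordinal.{u} → Fn.{u} → Fn.{u}) (Y : Set Ordinal.{u})
    (η : Ordinal.{u}) (x : Fn.{u}) (c : Ordinal.{u}) : Fn.{u} :=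
  if c ≤ η then x else
    if _h : ∃ p, IsPred Y p c then
      J c (sInf {p | IsPred Y p c}) (path J Y η x (sInf {p | IsPred Y p c}))
    else fun ζ => if _h : ∃ c' ∈ Y, ζ < c' ∧ c' < c then
      path J Y η x (sInf {c' | c' ∈ Y ∧ ζ < c' ∧ c' < c}) ζ else 0
termination_by c
decreasing_by
  · exact (csInf_mem (s := {p | IsPred Y p c}) _h).2.1
  · exact (csInf_mem (s := {c' | c' ∈ Y ∧ ζ < c' ∧ c' < c}) _h).2.2

section path

variable {J J' : Ordinal.{u} → Ordinal.{u} → Fn.{u} → Fn.{u}} {Y Y' : Set Ordinal.{u}}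
  {η : Ordinal.{u}} {x : Fn.{u}} {c : Ordinal.{u}}

theorem path_of_le (h : c ≤ η) : path J Y η x c = x := by rw [path, if_pos h]

theorem path_of_isPred {p : Ordinal.{u}} (h : η < c) (hp : IsPred Y p c) :
    path J Y η x c = J c p (path J Y η x p) := by
  rw [path, if_neg h.not_ge, dif_pos ⟨p, hp⟩, sInf_isPred hp]

theorem path_of_not_isPred (h : η < c) (hp : ¬ ∃ p, IsPred Y p c) :
    path J Y η x c = glue Y c (path J Y η x) := by
  rw [path, if_neg h.not_ge, dif_neg hp]
  funext ζ
  by_cases h' : ∃ c' ∈ Y, ζ < c' ∧ c' < c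
  · rw [dif_pos h', glue, if_pos h']
  · rw [dif_neg h', glue, if_neg h']

theorem isPred_congr (hY : ∀ d < c, d ∈ Y ↔ d ∈ Y') (p : Ordinal.{u}) :
    IsPred Y p c ↔ IsPred Y' p c :=
  ⟨fun h => ⟨(hY _ h.2.1).1 h.1, h.2.1, fun q hq hqc => h.2.2 q ((hY _ hqc).2 hq) hqc⟩,
    fun h => ⟨(hY _ h.2.1).2 h.1, h.2.1, fun q hq hqc => h.2.2 q ((hY _ hqc).1 hq) hqc⟩⟩

/-- Locality of paths: it justifies the recursion on levels, and with coherence identifies paths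
along two ladders. -/
theorem path_congr {α : Ordinal.{u}} (hJ : ∀ d < α, J d = J' d) (hY : ∀ d < α, d ∈ Y ↔ d ∈ Y')
    (hc : c < α) : path J Y η x c = path J' Y' η x c := by
  induction c using WellFoundedLT.induction with
  | ind c ih =>
    by_cases h : c ≤ η
    · rw [path_of_le h, path_of_le h]
    push Not at h
    have hY' : ∀ d < c, d ∈ Y ↔ d ∈ Y' := fun d hd => hY d (hd.trans hc)
    by_cases hp : ∃ p, IsPred Y p c
    · obtain ⟨p, hp⟩ := hp
      rw [path_of_isPred h hp, path_of_isPred h ((isPred_congr hY' p).1 hp), hJ c hc,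
        ih p hp.2.1 (hp.2.1.trans hc)]
    · have hp' : ¬ ∃ p, IsPred Y' p c := fun ⟨p, h⟩ => hp ⟨p, (isPred_congr hY' p).2 h⟩
      rw [path_of_not_isPred h hp, path_of_not_isPred h hp']
      exact glue_congr hY' fun d hd => ih d hd (hd.trans hc)

end path

/-! ### The tree -/

/-- The data for the construction of the tree: the ladder system `D`, the set `S` of the heights at
which antichains are anticipated, a diamond sequence `F` on `lam`. -/
structure Blueprint : Type (u + 1) where
  lam : Cardinal.{u}
  S : Set Ordinal.{u}
  D : Ordinal.{u} → Set Ordinal.{u}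
  F : Ordinal.{u} → Ordinal.{u} → Ordinal.{u}

/-- A level of the tree, together with the two ways to extend nodes of smaller height to it. -/
structure Stage : Type (u + 1) where
  lev : Set Fn.{u}
  ext : Ordinal.{u} → Fn.{u} → Fn.{u}
  jmp : Ordinal.{u} → Fn.{u} → Fn.{u}

instance : Inhabited Stage.{u} := ⟨⟨∅, fun _ x => x, fun _ x => x⟩⟩

open Classical in
/-- An injection of `A` into the ordinals below `lam`, if there is one. -/
def code (lam : Cardinal.{u}) (A : Set Fn.{u}) : Fn.{u} → Ordinal.{u} :=
  if h : ∃ e : Fn.{u} → Ordinal.{u}, Set.InjOn e A ∧ ∀ x ∈ A, e x < lam.ord then h.choose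
  else fun _ => 0

namespace Blueprint

variable (B : Blueprint.{u})

/-- The canonical extension of `x` to height `α`. -/
def extStep (α : Ordinal.{u}) (R : Ordinal.{u} → Stage.{u}) (η : Ordinal.{u}) (x : Fn.{u}) :
    Fn.{u} :=
  glue (start (B.D α) η) α (path (fun c => (R c).jmp) (start (B.D α) η) η x)

/-- The diamond sequence guesses the branch `f` through the tree below `α`. -/
def Guessed (α : Ordinal.{u}) (R : Ordinal.{u} → Stage.{u}) (f : Fn.{u}) : Prop :=
  rk (B.D α) α < B.lam.ord ∧ ∀ c ∈ B.D α, c < α →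
    code B.lam (R c).lev (restr f c) = B.F (rk (B.D α) α) (rk (B.D α) c)

/-- The height on the path from `x` to `α` at which we look for an element of an antichain. -/
def jumpHeight (n : ℕ) (α η : Ordinal.{u}) : Ordinal.{u} :=
  -- Waiting for `n` rungs keeps the detour at `α` above any given smaller height once `n` is large.
  sInf {δ | δ ∈ start (B.D α) η ∧ δ < α ∧ n ≤ (B.D α ∩ Set.Iio δ).ncard}

/-- `p` is a node which extends `x`, extends the canonical path to `α` from `x` up to the jump
height, and extends an element of the antichain that is anticipated at `α`. -/
def JumpsTo (n : ℕ) (Z : Ordinal.{u} → Ordinal.{u} → Set Fn.{u}) (α : Ordinal.{u})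
    (R : Ordinal.{u} → Stage.{u}) (η : Ordinal.{u}) (x : Fn.{u}) (p : Ordinal.{u} × Fn.{u}) :
    Prop :=
  B.jumpHeight n α η ≤ p.1 ∧ p.1 < α ∧ p.2 ∈ (R p.1).lev ∧
    restr p.2 (B.jumpHeight n α η) =
      path (fun c => (R c).jmp) (start (B.D α) η) η x (B.jumpHeight n α η) ∧
    η ≤ p.1 ∧ restr p.2 η = x ∧ ∃ ε ≤ p.1, restr p.2 ε ∈ Z α ε

open Classical in
/-- One step of the recursion. -/
def step (n : ℕ) (Z : Ordinal.{u} → Ordinal.{u} → Set Fn.{u}) (α : Ordinal.{u})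
    (R : Ordinal.{u} → Stage.{u}) : Stage.{u} where
  ext := B.extStep α R
  lev := {f | (∀ ζ, α ≤ ζ → f ζ = 0) ∧ (∀ ζ < α, f ζ < max B.lam.ord ζ) ∧
    (∀ β < α, restr f β ∈ (R β).lev) ∧
    -- Exempting canonical extensions from the omission is what keeps the tree normal.
    (Order.IsSuccLimit α → B.Guessed α R f → ∃ η < α, B.extStep α R η (restr f η) = f)}
  jmp := fun η x =>
    if α ∈ B.S ∧ ∃ p, B.JumpsTo n Z α R η x p then
      B.extStep α R (Classical.epsilon (B.JumpsTo n Z α R η x)).1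
        (Classical.epsilon (B.JumpsTo n Z α R η x)).2
    else B.extStep α R η x

theorem extStep_congr {α : Ordinal.{u}} {R R' : Ordinal.{u} → Stage.{u}}
    (h : ∀ β < α, R β = R' β) : B.extStep α R = B.extStep α R' := by
  funext η x
  exact glue_congr (fun _ _ => Iff.rfl) fun d hd =>
    path_congr (α := α) (fun e he => by rw [h e he]) (fun _ _ => Iff.rfl) hd

theorem guessed_congr {α : Ordinal.{u}} {R R' : Ordinal.{u} → Stage.{u}}
    (h : ∀ β < α, R β = R' β) : B.Guessed α R = B.Guessed α R' := by
  funext f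
  refine propext (and_congr_right fun _ => ?_)
  refine forall_congr' fun c => forall_congr' fun _ => forall_congr' fun hc => ?_
  rw [h c hc]

theorem jumpsTo_congr {n : ℕ} {Z : Ordinal.{u} → Ordinal.{u} → Set Fn.{u}} {α : Ordinal.{u}}
    {R R' : Ordinal.{u} → Stage.{u}} (h : ∀ β < α, R β = R' β) :
    B.JumpsTo n Z α R = B.JumpsTo n Z α R' := by
  funext η x p
  have hp : path (fun c => (R c).jmp) (start (B.D α) η) η x (B.jumpHeight n α η) =
      path (fun c => (R' c).jmp) (start (B.D α) η) η x (B.jumpHeight n α η) := by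
    by_cases hlt : B.jumpHeight n α η < α
    · exact path_congr (α := α) (fun e he => by rw [h e he]) (fun _ _ => Iff.rfl) hlt
    -- If no admissible height exists, the infimum is `0`, where every path still equals `x`.
    · have : B.jumpHeight n α η = 0 := by
        by_contra hne
        refine hlt (csInf_mem (s := {δ | δ ∈ start (B.D α) η ∧ δ < α ∧
          n ≤ (B.D α ∩ Set.Iio δ).ncard}) ?_).2.1
        by_contra hemp
        rw [Set.not_nonempty_iff_eq_empty] at hemp
        exact hne (by rw [jumpHeight, hemp, Ordinal.sInf_empty])
      rw [this, path_of_le zero_le, path_of_le zero_le]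
  rw [JumpsTo, JumpsTo, hp]
  refine propext (and_congr_right fun _ => and_congr_right fun h1 => ?_)
  rw [h _ h1]

theorem step_congr {n : ℕ} {Z : Ordinal.{u} → Ordinal.{u} → Set Fn.{u}} {α : Ordinal.{u}}
    {R R' : Ordinal.{u} → Stage.{u}} (h : ∀ β < α, R β = R' β) :
    B.step n Z α R = B.step n Z α R' := by
  have h3 : ∀ f : Fn.{u}, (∀ β < α, restr f β ∈ (R β).lev) ↔ ∀ β < α, restr f β ∈ (R' β).lev :=
    fun f => forall_congr' fun β => forall_congr' fun hβ => by rw [h β hβ]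
  rw [step, step, B.extStep_congr h, B.guessed_congr h, B.jumpsTo_congr h]
  simp only [h3]

open Classical in
/-- The tree with its extension maps. -/
def stage (n : ℕ) (Z : Ordinal.{u} → Ordinal.{u} → Set Fn.{u}) (α : Ordinal.{u}) : Stage.{u} :=
  B.step n Z α fun β => if β < α then stage n Z β else default
termination_by α

/-- The `default` stages at and above `α` are never consulted. -/
theorem stage_eq (n : ℕ) (Z : Ordinal.{u} → Ordinal.{u} → Set Fn.{u}) (α : Ordinal.{u}) :
    B.stage n Z α = B.step n Z α (B.stage n Z) := by
  rw [stage]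
  exact B.step_congr fun β hβ => if_pos hβ

end Blueprint

/-! ### Canonical paths and extensions -/

namespace Blueprint

variable (B : Blueprint.{u}) (n : ℕ) (Z : Ordinal.{u} → Ordinal.{u} → Set Fn.{u})

/-- The nodes of height `α`. -/
def lev (α : Ordinal.{u}) : Set Fn.{u} := (B.stage n Z α).lev

/-- The canonical extension to height `α`. -/
def ext (α η : Ordinal.{u}) (x : Fn.{u}) : Fn.{u} := (B.stage n Z α).ext η x

/-- The extension to height `α` which also tries to pass through an element of the antichain that is
anticipated at `α`. -/
def jmp (α η : Ordinal.{u}) (x : Fn.{u}) : Fn.{u} := (B.stage n Z α).jmp η x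

/-- The canonical path to `α`. -/
def cpath (α η : Ordinal.{u}) (x : Fn.{u}) : Ordinal.{u} → Fn.{u} :=
  path (B.jmp n Z) (start (B.D α) η) η x

/-- The diamond sequence guesses `f` at height `α`. -/
def Guess (α : Ordinal.{u}) (f : Fn.{u}) : Prop :=
  rk (B.D α) α < B.lam.ord ∧ ∀ c ∈ B.D α, c < α →
    code B.lam (B.lev n Z c) (restr f c) = B.F (rk (B.D α) α) (rk (B.D α) c)

/-- A target of a jump. -/
def IsTarget (α η : Ordinal.{u}) (x : Fn.{u}) (p : Ordinal.{u} × Fn.{u}) : Prop :=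
  B.jumpHeight n α η ≤ p.1 ∧ p.1 < α ∧ p.2 ∈ B.lev n Z p.1 ∧
    restr p.2 (B.jumpHeight n α η) = B.cpath n Z α η x (B.jumpHeight n α η) ∧
    η ≤ p.1 ∧ restr p.2 η = x ∧ ∃ ε ≤ p.1, restr p.2 ε ∈ Z α ε

variable {B n Z}

theorem ext_eq (α η : Ordinal.{u}) (x : Fn.{u}) :
    B.ext n Z α η x = glue (start (B.D α) η) α (B.cpath n Z α η x) := by
  rw [ext, stage_eq]; rfl

theorem mem_lev {α : Ordinal.{u}} {f : Fn.{u}} :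
    f ∈ B.lev n Z α ↔ (∀ ζ, α ≤ ζ → f ζ = 0) ∧ (∀ ζ < α, f ζ < max B.lam.ord ζ) ∧
      (∀ β < α, restr f β ∈ B.lev n Z β) ∧
      (Order.IsSuccLimit α → B.Guess n Z α f → ∃ η < α, B.ext n Z α η (restr f η) = f) := by
  simp only [ext_eq]
  rw [lev, stage_eq]; rfl

theorem jmp_of_not {α η : Ordinal.{u}} {x : Fn.{u}}
    (h : ¬ (α ∈ B.S ∧ ∃ p, B.IsTarget n Z α η x p)) : B.jmp n Z α η x = B.ext n Z α η x := by
  rw [ext_eq, jmp, stage_eq]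
  exact if_neg h

theorem jmp_of_notMem {α η : Ordinal.{u}} {x : Fn.{u}} (h : α ∉ B.S) :
    B.jmp n Z α η x = B.ext n Z α η x :=
  jmp_of_not fun h' => h h'.1

theorem exists_jmp {α η : Ordinal.{u}} {x : Fn.{u}}
    (h : α ∈ B.S ∧ ∃ p, B.IsTarget n Z α η x p) :
    ∃ ε y, B.IsTarget n Z α η x (ε, y) ∧ B.jmp n Z α η x = B.ext n Z α ε y := by
  refine ⟨(Classical.epsilon (B.IsTarget n Z α η x)).1,
    (Classical.epsilon (B.IsTarget n Z α η x)).2, Classical.epsilon_spec h.2, ?_⟩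
  rw [ext_eq, jmp, stage_eq]
  exact if_pos h

theorem supp_of_mem_lev {α : Ordinal.{u}} {f : Fn.{u}} (h : f ∈ B.lev n Z α) {ζ : Ordinal.{u}}
    (hζ : α ≤ ζ) : f ζ = 0 := (mem_lev.1 h).1 ζ hζ

theorem restr_eq_of_mem_lev {α : Ordinal.{u}} {f : Fn.{u}} (h : f ∈ B.lev n Z α) :
    restr f α = f := restr_eq_self fun _ => supp_of_mem_lev h

theorem restr_mem_lev {α β : Ordinal.{u}} {f : Fn.{u}} (h : f ∈ B.lev n Z α) (hβ : β ≤ α) :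
    restr f β ∈ B.lev n Z β := by
  rcases hβ.eq_or_lt with rfl | hβ
  · rwa [restr_eq_of_mem_lev h]
  · exact (mem_lev.1 h).2.2.1 β hβ

/-- If the supremum of the points of `start X η` below `c` is attained, it is the predecessor.
Otherwise it is a limit point of `X`, and closedness forces it to be `c`. -/
theorem isPred_or_isLim {X : Set Ordinal.{u}} {η c α : Ordinal.{u}} (hη : η < c) (hc : c ≤ α)
    (hcl : ∀ β < α, IsLim X β → β ∈ X) : (∃ p, IsPred (start X η) p c) ∨ IsLim X c := by
  by_cases hp : ∃ p, IsPred (start X η) p c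
  · exact Or.inl hp
  right
  set A := start X η ∩ Set.Iio c with hA
  have hbdd : BddAbove A := ⟨c, fun a ha => le_of_lt ha.2⟩
  have hηA : η ∈ A := ⟨self_mem_start X η, hη⟩
  have hle : sSup A ≤ c := csSup_le' fun a ha => le_of_lt ha.2
  have hnA : sSup A ∉ A := fun h => hp ⟨_, h.1, h.2, fun q hq hqc => le_csSup hbdd ⟨hq, hqc⟩⟩
  have hηs : η < sSup A := lt_of_le_of_ne (le_csSup hbdd hηA) fun h => hnA (h ▸ hηA)
  have hlim : IsLim X (sSup A) := by
    refine ⟨zero_le.trans_lt hηs, fun γ hγ => ?_⟩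
    obtain ⟨a, ha, hlt⟩ := exists_lt_of_lt_csSup' (max_lt hγ hηs)
    refine ⟨a, ?_, (le_max_left _ _).trans_lt hlt,
      lt_of_le_of_ne (le_csSup hbdd ha) fun h => hnA (h ▸ ha)⟩
    rcases ha.1 with h | h
    · exact absurd h ((le_max_right _ _).trans_lt hlt).ne'
    · exact h.1
  rcases hle.eq_or_lt with h | h
  · rwa [h] at hlim
  · exact absurd ⟨Or.inr ⟨hcl _ (h.trans_le hc) hlim, hηs⟩, h⟩ hnA

/-- The map `E` extends nodes of smaller height to nodes of height `α`. -/
def Extends (B : Blueprint.{u}) (n : ℕ) (Z : Ordinal.{u} → Ordinal.{u} → Set Fn.{u})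
    (α : Ordinal.{u}) (E : Ordinal.{u} → Fn.{u} → Fn.{u}) : Prop :=
  ∀ η < α, ∀ x ∈ B.lev n Z η, E η x ∈ B.lev n Z α ∧ restr (E η x) η = x


/-- By coherence, the ladder at `c` is the part of `D α` below `c`, so both climbs use the same
rungs. -/
theorem cpath_eq_ext {κ : Cardinal.{u}} (hL : IsLadder κ B.lam B.S B.D) {α η c : Ordinal.{u}}
    {x : Fn.{u}} (hα : α < κ.ord) (hη : η < c) (hc : c < α) (hlim : IsLim (B.D α) c) :
    B.cpath n Z α η x c = B.ext n Z c η x := by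
  have hp : ¬ ∃ p, IsPred (start (B.D α) η) p c := by
    rintro ⟨p, hp⟩
    obtain ⟨d, hd, hpd, hdc⟩ := hlim.2 p hp.2.1
    exact absurd (hp.2.2 d (Or.inr ⟨hd, (le_of_mem_start hp.1).trans_lt hpd⟩) hdc) hpd.not_ge
  have hY : ∀ d < c, d ∈ start (B.D α) η ↔ d ∈ start (B.D c) η := fun d hd => by
    rw [start, start, Set.mem_ofPred_eq, Set.mem_ofPred_eq, hL.coherent α hα c hc hlim d hd]
  rw [cpath, path_of_not_isPred hη hp, ext_eq, cpath]
  exact glue_congr hY fun d hd => path_congr (fun _ _ => rfl) hY hd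

/-- At a rung with a predecessor the node arises by a jump, at a limit rung it is a canonical
extension; `ih` covers both. -/
theorem cpath_mem {κ : Cardinal.{u}} (hL : IsLadder κ B.lam B.S B.D) {α η : Ordinal.{u}}
    {x : Fn.{u}} (hα : α < κ.ord) (hx : x ∈ B.lev n Z η)
    (ih : ∀ β < α, Extends B n Z β (B.ext n Z β) ∧ Extends B n Z β (B.jmp n Z β))
    {c : Ordinal.{u}} (hc : c < α) (hcY : c ∈ start (B.D α) η) :
    B.cpath n Z α η x c ∈ B.lev n Z c ∧
      ∀ d ∈ start (B.D α) η, d ≤ c → restr (B.cpath n Z α η x c) d = B.cpath n Z α η x d := by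
  induction c using WellFoundedLT.induction with
  | ind c ihc =>
    have hself : B.cpath n Z α η x c ∈ B.lev n Z c →
        (∀ d ∈ start (B.D α) η, d < c →
          restr (B.cpath n Z α η x c) d = B.cpath n Z α η x d) →
        B.cpath n Z α η x c ∈ B.lev n Z c ∧ ∀ d ∈ start (B.D α) η, d ≤ c →
          restr (B.cpath n Z α η x c) d = B.cpath n Z α η x d := by
      intro h1 h2
      refine ⟨h1, fun d hd hdc => ?_⟩
      rcases hdc.eq_or_lt with rfl | hdc
      · exact restr_eq_of_mem_lev h1
      · exact h2 d hd hdc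
    rcases (le_of_mem_start hcY).eq_or_lt with rfl | hη
    · refine hself (by rwa [cpath, path_of_le le_rfl]) fun d hd hdc => ?_
      exact absurd (le_of_mem_start hd) hdc.not_ge
    rcases isPred_or_isLim hη hc.le (hL.closed α hα) with ⟨p, hp⟩ | hlim
    · obtain ⟨h1, h2⟩ := ihc p hp.2.1 (hp.2.1.trans hc) hp.1
      obtain ⟨h3, h4⟩ := (ih c hc).2 p hp.2.1 _ h1
      have he : B.cpath n Z α η x c = B.jmp n Z c p (B.cpath n Z α η x p) := path_of_isPred hη hp
      rw [← he] at h3 h4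
      refine hself h3 fun d hd hdc => ?_
      have hdp := hp.2.2 d hd hdc
      rw [← h2 d hd hdp, ← h4, restr_restr _ hdp]
    · have he := cpath_eq_ext (n := n) (Z := Z) (x := x) hL hα hη hc hlim
      have hp : ¬ ∃ p, IsPred (start (B.D α) η) p c := by
        rintro ⟨p, hp⟩
        obtain ⟨d, hd, hpd, hdc⟩ := hlim.2 p hp.2.1
        exact absurd (hp.2.2 d (Or.inr ⟨hd, (le_of_mem_start hp.1).trans_lt hpd⟩) hdc) hpd.not_ge
      refine hself (he ▸ ((ih c hc).1 η hη x hx).1) fun d hd hdc => ?_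
      have hg : B.cpath n Z α η x c = glue (start (B.D α) η) c (B.cpath n Z α η x) :=
        path_of_not_isPred hη hp
      rw [hg]
      exact restr_glue hd hdc (ihc d hdc (hdc.trans hc) hd).2

theorem restr_ext_of_ih {κ : Cardinal.{u}} (hL : IsLadder κ B.lam B.S B.D) {α η : Ordinal.{u}}
    {x : Fn.{u}} (hα : α < κ.ord) (hx : x ∈ B.lev n Z η)
    (ih : ∀ β < α, Extends B n Z β (B.ext n Z β) ∧ Extends B n Z β (B.jmp n Z β))
    {c : Ordinal.{u}} (hc : c < α) (hcY : c ∈ start (B.D α) η) :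
    restr (B.ext n Z α η x) c = B.cpath n Z α η x c := by
  rw [ext_eq]
  exact restr_glue hcY hc (cpath_mem hL hα hx ih hc hcY).2

theorem exists_mem_start {κ : Cardinal.{u}} (hL : IsLadder κ B.lam B.S B.D) {α η β : Ordinal.{u}}
    (hα : α < κ.ord) (hη : η < α) (hβ : β < α) : ∃ c ∈ start (B.D α) η, c < α ∧ β ≤ c := by
  obtain ⟨c, hc, hle⟩ := hL.cofinal α hα β hβ
  by_cases h : η < c
  · exact ⟨c, Or.inr ⟨hc, h⟩, hL.below α hα c hc, hle⟩
  · exact ⟨η, Or.inl rfl, hη, hle.trans (not_lt.1 h)⟩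

/-- A canonical extension cannot be omitted from its level, since `η` itself witnesses the
exemption. A jump is a canonical extension of another node above `x`. -/
theorem extends_ext_jmp {κ : Cardinal.{u}} (hL : IsLadder κ B.lam B.S B.D) (h0 : 0 < B.lam.ord)
    {α : Ordinal.{u}} (hα : α < κ.ord) :
    Extends B n Z α (B.ext n Z α) ∧ Extends B n Z α (B.jmp n Z α) := by
  induction α using WellFoundedLT.induction with
  | ind α ih' =>
    have ih : ∀ β < α, Extends B n Z β (B.ext n Z β) ∧ Extends B n Z β (B.jmp n Z β) :=
      fun β hβ => ih' β hβ (hβ.trans hα)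
    have hE : Extends B n Z α (B.ext n Z α) := by
      intro η hη x hx
      have hr := fun c hc hcY => restr_ext_of_ih hL hα hx ih (c := c) hc hcY
      have hm := fun c hc hcY => cpath_mem hL hα hx ih (c := c) hc hcY
      have hrη : restr (B.ext n Z α η x) η = x := by
        rw [hr η hη (self_mem_start _ _), cpath, path_of_le le_rfl]
      refine ⟨mem_lev.2 ⟨fun ζ hζ => ?_, fun ζ hζ => ?_, fun β hβ => ?_, fun _ _ =>
        ⟨η, hη, by rw [hrη]⟩⟩, hrη⟩
      · rw [ext_eq]; exact glue_of_le hζ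
      · by_cases hex : ∃ c ∈ start (B.D α) η, ζ < c ∧ c < α
        · obtain ⟨c, hc, hζc, hcα⟩ := hex
          rw [← restr_of_lt (B.ext n Z α η x) hζc, hr c hcα hc]
          exact (mem_lev.1 (hm c hcα hc).1).2.1 ζ hζc
        · rw [ext_eq, glue, if_neg hex]
          exact h0.trans_le (le_max_left _ _)
      · obtain ⟨c, hc, hcα, hle⟩ := exists_mem_start hL hα hη hβ
        rw [← restr_restr _ hle, hr c hcα hc]
        exact restr_mem_lev (hm c hcα hc).1 hle
    refine ⟨hE, fun η hη x hx => ?_⟩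
    by_cases h : α ∈ B.S ∧ ∃ p, B.IsTarget n Z α η x p
    · obtain ⟨ε, y, ⟨-, h2, h3, -, h5, h6, -⟩, he⟩ := exists_jmp h
      obtain ⟨h7, h8⟩ := hE ε h2 y h3
      rw [he]
      refine ⟨h7, ?_⟩
      rw [← restr_restr _ h5, h8, h6]
    · rw [jmp_of_not h]
      exact hE η hη x hx

end Blueprint

/-- The hypotheses on a blueprint. -/
structure Blueprint.IsGood (B : Blueprint.{u}) (κ : Cardinal.{u}) : Prop where
  lam_regular : B.lam.IsRegular
  lam_unc : ℵ₀ < B.lam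
  succ_eq : κ = Order.succ B.lam
  ladder : IsLadder κ B.lam B.S B.D
  diamond : ∀ f : Ordinal.{u} → Ordinal.{u}, (∀ ξ < B.lam.ord, f ξ < B.lam.ord) →
    ∀ h : Ordinal.{u} → Ordinal.{u}, (∀ ξ < B.lam.ord, h ξ < B.lam.ord) →
      ∃ β < B.lam.ord, Order.IsSuccLimit β ∧ (∀ ξ < β, h ξ < β) ∧ ∀ ξ < β, f ξ = B.F β ξ

namespace Blueprint.IsGood

variable {B : Blueprint.{u}} {κ : Cardinal.{u}} {n : ℕ}
  {Z : Ordinal.{u} → Ordinal.{u} → Set Fn.{u}}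

theorem lam_lt (hB : B.IsGood κ) : B.lam < κ := hB.succ_eq ▸ Order.lt_succ _

theorem lam_ord_lt (hB : B.IsGood κ) : B.lam.ord < κ.ord := Cardinal.ord_lt_ord.2 hB.lam_lt

theorem regular (hB : B.IsGood κ) : κ.IsRegular :=
  hB.succ_eq ▸ Cardinal.isRegular_succ hB.lam_regular.1

theorem unc (hB : B.IsGood κ) : ℵ₀ < κ := hB.lam_unc.trans hB.lam_lt

theorem ext_mem (hB : B.IsGood κ) {α η : Ordinal.{u}} {x : Fn.{u}} (hα : α < κ.ord) (hη : η < α)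
    (hx : x ∈ B.lev n Z η) : B.ext n Z α η x ∈ B.lev n Z α :=
  ((extends_ext_jmp hB.ladder hB.lam_regular.ord_pos hα).1 η hη x hx).1

theorem restr_ext (hB : B.IsGood κ) {α η : Ordinal.{u}} {x : Fn.{u}} (hα : α < κ.ord) (hη : η < α)
    (hx : x ∈ B.lev n Z η) : restr (B.ext n Z α η x) η = x :=
  ((extends_ext_jmp hB.ladder hB.lam_regular.ord_pos hα).1 η hη x hx).2

theorem jmp_mem (hB : B.IsGood κ) {α η : Ordinal.{u}} {x : Fn.{u}} (hα : α < κ.ord) (hη : η < α)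
    (hx : x ∈ B.lev n Z η) : B.jmp n Z α η x ∈ B.lev n Z α :=
  ((extends_ext_jmp hB.ladder hB.lam_regular.ord_pos hα).2 η hη x hx).1

theorem cpath_mem (hB : B.IsGood κ) {α η c : Ordinal.{u}} {x : Fn.{u}} (hα : α < κ.ord)
    (hx : x ∈ B.lev n Z η) (hc : c < α) (hcY : c ∈ start (B.D α) η) :
    B.cpath n Z α η x c ∈ B.lev n Z c :=
  (Blueprint.cpath_mem hB.ladder hα hx (fun _ hβ => extends_ext_jmp hB.ladder
    hB.lam_regular.ord_pos (hβ.trans hα)) hc hcY).1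

theorem restr_cpath (hB : B.IsGood κ) {α η c d : Ordinal.{u}} {x : Fn.{u}} (hα : α < κ.ord)
    (hx : x ∈ B.lev n Z η) (hc : c < α) (hcY : c ∈ start (B.D α) η) (hd : d ∈ start (B.D α) η)
    (hdc : d ≤ c) : restr (B.cpath n Z α η x c) d = B.cpath n Z α η x d :=
  (Blueprint.cpath_mem hB.ladder hα hx (fun _ hβ => extends_ext_jmp hB.ladder
    hB.lam_regular.ord_pos (hβ.trans hα)) hc hcY).2 d hd hdc

theorem restr_ext_eq_cpath (hB : B.IsGood κ) {α η c : Ordinal.{u}} {x : Fn.{u}} (hα : α < κ.ord)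
    (hx : x ∈ B.lev n Z η) (hc : c < α) (hcY : c ∈ start (B.D α) η) :
    restr (B.ext n Z α η x) c = B.cpath n Z α η x c :=
  restr_ext_of_ih hB.ladder hα hx (fun _ hβ => extends_ext_jmp hB.ladder
    hB.lam_regular.ord_pos (hβ.trans hα)) hc hcY

end Blueprint.IsGood

theorem code_lt {lam : Cardinal.{u}} (h0 : 0 < lam.ord) {A : Set Fn.{u}} {x : Fn.{u}}
    (hx : x ∈ A) : code lam A x < lam.ord := by
  rw [code]
  split_ifs with h
  · exact h.choose_spec.2 x hx
  · exact h0

theorem code_injOn {lam : Cardinal.{u}} {A : Set Fn.{u}}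
    (h : #A ≤ Cardinal.lift.{u + 1} lam) : Set.InjOn (code lam A) A := by
  classical
  have : ∃ e : Fn.{u} → Ordinal.{u}, Set.InjOn e A ∧ ∀ x ∈ A, e x < lam.ord := by
    have h' : #A ≤ #(Set.Iio lam.ord) := by rwa [Cardinal.mk_Iio_ordinal, Cardinal.card_ord]
    obtain ⟨g⟩ := Cardinal.le_def _ _ |>.1 h'
    refine ⟨fun x => if hx : x ∈ A then (g ⟨x, hx⟩).1 else 0, fun x hx y hy hxy => ?_,
      fun x hx => ?_⟩
    · simp only [hx, hy, dif_pos] at hxy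
      exact congrArg Subtype.val (g.injective (Subtype.ext hxy))
    · simp only [hx, dif_pos]
      exact (g ⟨x, hx⟩).2
  rw [code, dif_pos this]
  exact this.choose_spec.1

theorem mk_le_of_code {lam : Cardinal.{u}} {A : Set Fn.{u}} (e : Fn.{u} → Ordinal.{u})
    (he : Set.InjOn e A) (hlt : ∀ x ∈ A, e x < lam.ord) : #A ≤ Cardinal.lift.{u + 1} lam := by
  have : #A ≤ #(Set.Iio lam.ord) :=
    Cardinal.mk_le_of_injective (f := fun x : A => (⟨e x, hlt x x.2⟩ : Set.Iio lam.ord))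
      fun x y hxy => Subtype.ext (he x.2 y.2 (congrArg Subtype.val hxy))
  rwa [Cardinal.mk_Iio_ordinal, Cardinal.card_ord] at this

/-! ### Branches at limit heights and the size of levels -/

namespace Blueprint.IsGood

variable {B : Blueprint.{u}} {κ : Cardinal.{u}} {n : ℕ}
  {Z : Ordinal.{u} → Ordinal.{u} → Set Fn.{u}}

theorem exists_lt_mem (hB : B.IsGood κ) {α β : Ordinal.{u}} (hα : α < κ.ord)
    (hl : Order.IsSuccLimit α) (hβ : β < α) : ∃ c ∈ B.D α, β < c ∧ c < α := by
  obtain ⟨c, hc, hle⟩ := hB.ladder.cofinal α hα _ (hl.succ_lt hβ)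
  exact ⟨c, hc, (Order.lt_succ β).trans_le hle, hB.ladder.below α hα c hc⟩

/-- A canonical path has no memory: its continuation from a rung depends only on the node reached
there. -/
theorem cpath_restart (hB : B.IsGood κ) {α η c₀ c : Ordinal.{u}} {x : Fn.{u}} (hα : α < κ.ord)
    (hx : x ∈ B.lev n Z η) (hc₀ : c₀ ∈ start (B.D α) η) (hc₀α : c₀ < α)
    (hc : c ∈ start (B.D α) c₀) (hcα : c < α) :
    B.cpath n Z α c₀ (B.cpath n Z α η x c₀) c = B.cpath n Z α η x c := by
  set y := B.cpath n Z α η x c₀ with hy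
  have hsub : ∀ d ∈ start (B.D α) c₀, d ∈ start (B.D α) η := by
    rintro d (rfl | hd)
    · exact hc₀
    · exact Or.inr ⟨hd.1, (le_of_mem_start hc₀).trans_lt hd.2⟩
  have hym : y ∈ B.lev n Z c₀ := hB.cpath_mem hα hx hc₀α hc₀
  induction c using WellFoundedLT.induction with
  | ind c ih =>
    rcases (le_of_mem_start hc).eq_or_lt with rfl | hlt
    · rw [cpath, path_of_le le_rfl]
    rcases isPred_or_isLim hlt hcα.le (hB.ladder.closed α hα) with ⟨p, hp⟩ | hlim
    · have hp' : IsPred (start (B.D α) η) p c := by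
        refine ⟨hsub p hp.1, hp.2.1, fun q hq hqc => ?_⟩
        by_cases hqc₀ : c₀ < q
        · refine hp.2.2 q (Or.inr ⟨?_, hqc₀⟩) hqc
          rcases hq with rfl | hq
          · exact absurd (le_of_mem_start hc₀) hqc₀.not_ge
          · exact hq.1
        · exact (not_lt.1 hqc₀).trans (le_of_mem_start hp.1)
      rw [cpath, path_of_isPred hlt hp, cpath, path_of_isPred ((le_of_mem_start hc₀).trans_lt hlt)
        hp', ← cpath, ← cpath, ih p hp.2.1 hp.1 (hp.2.1.trans hcα)]
    · have h1 := hB.cpath_mem hα hym hcα hc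
      have h2 := hB.cpath_mem hα hx hcα (hsub c hc)
      funext ζ
      by_cases hζ : ζ < c
      · obtain ⟨d, hd, hlt', hdc⟩ := hlim.2 (max ζ c₀) (max_lt hζ hlt)
        have hd' : d ∈ start (B.D α) c₀ := Or.inr ⟨hd, (le_max_right _ _).trans_lt hlt'⟩
        have hζd := (le_max_left _ _).trans_lt hlt'
        rw [← restr_of_lt (B.cpath n Z α c₀ y c) hζd, ← restr_of_lt (B.cpath n Z α η x c) hζd,
          hB.restr_cpath hα hym hcα hc hd' hdc.le,
          hB.restr_cpath hα hx hcα (hsub c hc) (hsub d hd') hdc.le, ih d hdc hd' (hdc.trans hcα)]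
      · rw [supp_of_mem_lev h1 (not_lt.1 hζ), supp_of_mem_lev h2 (not_lt.1 hζ)]

theorem ext_restart (hB : B.IsGood κ) {α η c₀ : Ordinal.{u}} {x : Fn.{u}} (hα : α < κ.ord)
    (hl : Order.IsSuccLimit α) (hx : x ∈ B.lev n Z η) (hc₀ : c₀ ∈ start (B.D α) η)
    (hc₀α : c₀ < α) :
    B.ext n Z α c₀ (B.cpath n Z α η x c₀) = B.ext n Z α η x := by
  have hym := hB.cpath_mem hα hx hc₀α hc₀
  have hηα : η < α := (le_of_mem_start hc₀).trans_lt hc₀α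
  funext ζ
  by_cases hζ : ζ < α
  · obtain ⟨d, hd, hlt, hdα⟩ := hB.exists_lt_mem hα hl (max_lt hζ hc₀α)
    have hζd := (le_max_left _ _).trans_lt hlt
    have hcd := (le_max_right _ _).trans_lt hlt
    have hd' : d ∈ start (B.D α) c₀ := Or.inr ⟨hd, hcd⟩
    rw [← restr_of_lt (B.ext n Z α c₀ _) hζd, ← restr_of_lt (B.ext n Z α η x) hζd,
      hB.restr_ext_eq_cpath hα hym hdα hd', hB.restr_ext_eq_cpath hα hx hdα
        (Or.inr ⟨hd, (le_of_mem_start hc₀).trans_lt hcd⟩), hB.cpath_restart hα hx hc₀ hc₀α hd' hdα]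
  · rw [supp_of_mem_lev (hB.ext_mem hα hc₀α hym) (not_lt.1 hζ),
      supp_of_mem_lev (hB.ext_mem hα hηα hx) (not_lt.1 hζ)]

/-- Below a point of limit rank, the rung following any given rung still lies below it, so no
predecessor can exist. -/
theorem isLim_of_rk (hB : B.IsGood κ) {α δ : Ordinal.{u}} (hα : α < κ.ord) (hδα : δ < α)
    (hl : Order.IsSuccLimit (rk (B.D α) δ)) : IsLim (B.D α) δ := by
  obtain ⟨c₀, hc₀, hc₀δ, -⟩ := exists_rk_eq hl.bot_lt
  rcases isPred_or_isLim hc₀δ hδα.le (hB.ladder.closed α hα) with ⟨p, hp⟩ | hlim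
  · have hpD : p ∈ B.D α := hp.1.elim (fun h => h ▸ hc₀) fun h => h.1
    obtain ⟨d, hd, hdδ, hrd⟩ := exists_rk_eq (hl.succ_lt (rk_lt hpD hp.2.1))
    have hpd : p < d := lt_of_rk_lt (by rw [hrd]; exact Order.lt_succ _)
    exact absurd (hp.2.2 d (Or.inr ⟨hd, (le_of_mem_start hp.1).trans_lt hpd⟩) hdδ) hpd.not_ge
  · exact hlim

/-- At a height of cofinality `lam`, every branch is canonical. -/
theorem exists_ext_eq (hB : B.IsGood κ) {α : Ordinal.{u}} {f : Fn.{u}} (hα : α < κ.ord)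
    (hl : Order.IsSuccLimit α) (hr : rk (B.D α) α = B.lam.ord) (hf0 : ∀ ζ, α ≤ ζ → f ζ = 0)
    (hf : ∀ β < α, restr f β ∈ B.lev n Z β) : ∃ η < α, B.ext n Z α η (restr f η) = f := by
  by_contra! hne
  -- `z η` will be a place where the canonical extension of `restr f η` departs from `f`.
  have h1 : ∀ η : Ordinal.{u}, ∃ ζ, η < α → ζ < α ∧ B.ext n Z α η (restr f η) ζ ≠ f ζ := by
    intro η
    by_cases hη : η < α
    · obtain ⟨ζ, hζ⟩ := Function.ne_iff.1 (hne η hη)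
      refine ⟨ζ, fun _ => ⟨?_, hζ⟩⟩
      by_contra! hle
      exact hζ (by rw [supp_of_mem_lev (hB.ext_mem hα hη (hf η hη)) hle, hf0 ζ hle])
    · exact ⟨0, fun h => absurd h hη⟩
  choose z hz using h1
  have h2 : ∀ ξ : Ordinal.{u}, ∃ c, ξ < B.lam.ord → c ∈ B.D α ∧ c < α ∧ rk (B.D α) c = ξ := by
    intro ξ
    by_cases hξ : ξ < B.lam.ord
    · rw [← hr] at hξ
      obtain ⟨c, hc⟩ := exists_rk_eq hξ
      exact ⟨c, fun _ => hc⟩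
    · exact ⟨0, fun h => absurd h hξ⟩
  choose c hc using h2
  -- In terms of ranks: the departure from the rung of rank `ξ` happens below the rung of rank `h
  -- ξ`.
  have h3 : ∀ ξ : Ordinal.{u}, ∃ ρ, ξ < B.lam.ord → ρ < B.lam.ord ∧ z (c ξ) < c ρ := by
    intro ξ
    by_cases hξ : ξ < B.lam.ord
    · obtain ⟨d, hd, hlt, hdα⟩ := hB.exists_lt_mem hα hl (hz _ (hc ξ hξ).2.1).1
      have hrd : rk (B.D α) d < B.lam.ord := hr ▸ rk_lt hd hdα
      refine ⟨rk (B.D α) d, fun _ => ⟨hrd, ?_⟩⟩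
      rwa [rk_injOn (hc _ hrd).1 hd (hc _ hrd).2.2]
    · exact ⟨0, fun h => absurd h hξ⟩
  choose h hh using h3
  -- Guess the codes of `f` along the ladder at a limit rank closed under `h`. At the corresponding
  -- rung `δ` the restriction of `f` is guessed and yet present, hence canonical.
  obtain ⟨β, hβ, hβl, hcl, hg⟩ := hB.diamond
    (fun ξ => open Classical in if ξ < B.lam.ord then
      code B.lam (B.lev n Z (c ξ)) (restr f (c ξ)) else 0) (by
      intro ξ hξ
      simp only [hξ, if_true]
      exact code_lt hB.lam_regular.ord_pos (hf _ (hc ξ hξ).2.1)) h fun ξ hξ => (hh ξ hξ).1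
  obtain ⟨hδ, hδα, hrδ⟩ := hc β hβ
  set δ := c β
  have hlim : IsLim (B.D α) δ := hB.isLim_of_rk hα hδα (by rwa [hrδ])
  have hco := hB.ladder.coherent α hα δ hδα hlim
  have hrk : ∀ d ≤ δ, rk (B.D δ) d = rk (B.D α) d := fun d hd =>
    rk_congr fun a ha => hco a (ha.trans_le hd)
  have hfδ := hf δ hδα
  have hδκ := hδα.trans hα
  have hgu : B.Guess n Z δ (restr f δ) := by
    rw [Guess, hrk δ le_rfl, hrδ]
    refine ⟨hβ, fun d hd hdδ => ?_⟩
    have hdD := (hco d hdδ).1 hd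
    rw [restr_restr _ hdδ.le, hrk d hdδ.le]
    have hrd : rk (B.D α) d < β := hrδ ▸ rk_lt hdD hdδ
    have hrd' := hrd.trans hβ
    have := hg _ hrd
    rw [if_pos hrd', rk_injOn (hc _ hrd').1 hdD (hc _ hrd').2.2] at this
    exact this
  obtain ⟨η, hη, he⟩ := (mem_lev.1 hfδ).2.2.2 hlim.isSuccLimit hgu
  rw [restr_restr _ hη.le] at he
  -- Restart at a rung `d`: the canonical path from `d` to `α` agrees with `f` up to `δ`, although
  -- it should depart at `z d < δ`.
  obtain ⟨d, hd, hηd, hdδ⟩ := hlim.2 η hη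
  have hdY : d ∈ start (B.D δ) η := Or.inr ⟨(hco d hdδ).2 hd, hηd⟩
  have hfη := hf η (hη.trans hδα)
  have h4 := hB.ext_restart hδκ hlim.isSuccLimit hfη hdY hdδ
  rw [he, ← hB.restr_ext_eq_cpath hδκ hfη hdδ hdY, he, restr_restr _ hdδ.le] at h4
  have hdα := hdδ.trans hδα
  have h5 := cpath_eq_ext (n := n) (Z := Z) (x := restr f d) hB.ladder hα hdδ hδα hlim
  rw [h4, ← hB.restr_ext_eq_cpath hα (hf d hdα) hδα (Or.inr ⟨hδ, hdδ⟩)] at h5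
  have hrd : rk (B.D α) d < β := hrδ ▸ rk_lt hd hdδ
  have hrd' := hrd.trans hβ
  have hcd : c (rk (B.D α) d) = d := rk_injOn (hc _ hrd').1 hd (hc _ hrd').2.2
  have h6 := (hh _ hrd').2
  rw [hcd] at h6
  have h7 : c (h (rk (B.D α) d)) < δ := by
    apply lt_of_rk_lt (X := B.D α)
    rw [(hc _ (hh _ hrd').1).2.2, hrδ]
    exact hcl _ hrd
  apply (hz d hdα).2
  rw [← restr_of_lt (B.ext n Z α d (restr f d)) (h6.trans h7), h5, restr_of_lt _ (h6.trans h7)]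

/-- Closure under the constant function `θ` pushes the guessing point beyond `θ`. Thus `F` lists all
sequences of length `θ` in `lam`. -/
theorem exists_F_eq (hB : B.IsGood κ) {θ : Ordinal.{u}} (hθ : θ < B.lam.ord)
    (f : Ordinal.{u} → Ordinal.{u}) (hf : ∀ ξ < B.lam.ord, f ξ < B.lam.ord) :
    ∃ β < B.lam.ord, ∀ ξ < θ, f ξ = B.F β ξ := by
  obtain ⟨β, hβ, hβl, hcl, hg⟩ := hB.diamond f hf (fun _ => θ) fun _ _ => hθ
  exact ⟨β, hβ, fun ξ hξ => hg ξ (hξ.trans (hcl 0 hβl.bot_lt))⟩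

theorem eq_of_code_eq {α : Ordinal.{u}} {f g : Fn.{u}} (hB : B.IsGood κ) (hα : α < κ.ord)
    (hl : Order.IsSuccLimit α) (hf0 : ∀ ζ, α ≤ ζ → f ζ = 0) (hg0 : ∀ ζ, α ≤ ζ → g ζ = 0)
    (hf : ∀ β < α, restr f β ∈ B.lev n Z β) (hg : ∀ β < α, restr g β ∈ B.lev n Z β)
    (hcard : ∀ β < α, #(B.lev n Z β) ≤ Cardinal.lift.{u + 1} B.lam)
    (h : ∀ c ∈ B.D α, c < α →
      code B.lam (B.lev n Z c) (restr f c) = code B.lam (B.lev n Z c) (restr g c)) : f = g := by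
  funext ζ
  by_cases hζ : ζ < α
  · obtain ⟨c, hc, hlt, hcα⟩ := hB.exists_lt_mem hα hl hζ
    rw [← restr_of_lt f hlt, ← restr_of_lt g hlt,
      code_injOn (hcard c hcα) (hf c hcα) (hg c hcα) (h c hc hcα)]
  · rw [hf0 ζ (not_lt.1 hζ), hg0 ζ (not_lt.1 hζ)]

theorem mk_Iio_le (hB : B.IsGood κ) {α : Ordinal.{u}} (hα : α < κ.ord) :
    #(Set.Iio α) ≤ Cardinal.lift.{u + 1} B.lam := by
  rw [Cardinal.mk_Iio_ordinal, Cardinal.lift_le]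
  rw [hB.succ_eq] at hα
  exact Order.lt_succ_iff.1 (Cardinal.lt_ord.1 hα)

/-- At ladder type `lam` a node is the canonical extension of one of `lam * lam` nodes below. At a
shorter ladder its codes agree with some `F β`, and `β` determines it. At a successor, count the
last value. -/
theorem mk_lev_le (hB : B.IsGood κ) {α : Ordinal.{u}} (hα : α < κ.ord) :
    #(B.lev n Z α) ≤ Cardinal.lift.{u + 1} B.lam := by
  have hinf : ℵ₀ ≤ Cardinal.lift.{u + 1} B.lam := Cardinal.aleph0_le_lift.2 hB.lam_unc.le
  induction α using WellFoundedLT.induction with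
  | ind α ih =>
    have ih' : ∀ β < α, #(B.lev n Z β) ≤ Cardinal.lift.{u + 1} B.lam := fun β hβ =>
      ih β hβ (hβ.trans hα)
    by_cases hl : Order.IsSuccLimit α
    · rcases (hB.ladder.rank_le α hα hl).eq_or_lt with hr | hr
      · have hsub : B.lev n Z α ⊆
            ⋃ η : Set.Iio α, (fun x => B.ext n Z α η.1 x) '' B.lev n Z η.1 := by
          intro f hf
          obtain ⟨η, hη, he⟩ := hB.exists_ext_eq hα hl hr (mem_lev.1 hf).1 (mem_lev.1 hf).2.2.1
          exact Set.mem_iUnion.2 ⟨⟨η, hη⟩, _, (mem_lev.1 hf).2.2.1 η hη, he⟩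
        refine (Cardinal.mk_le_mk_of_subset hsub).trans ?_
        refine (Cardinal.mk_iUnion_le_sum_mk).trans ?_
        refine (Cardinal.sum_le_sum _ (fun _ => Cardinal.lift.{u + 1} B.lam)
          fun (η : Set.Iio α) => Cardinal.mk_image_le.trans (ih' η.1 η.2)).trans ?_
        rw [Cardinal.sum_const']
        exact (mul_le_mul_left (hB.mk_Iio_le hα) _).trans (Cardinal.mul_eq_self hinf).le
      · have hex : ∀ f : Fn.{u}, ∃ β, f ∈ B.lev n Z α → β < B.lam.ord ∧ ∀ c ∈ B.D α, c < α →
            code B.lam (B.lev n Z c) (restr f c) = B.F β (rk (B.D α) c) := by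
          intro f
          by_cases hf : f ∈ B.lev n Z α
          · obtain ⟨β, hβ, h⟩ := hB.exists_F_eq hr
              (fun ξ => open Classical in if h : ∃ c ∈ B.D α, c < α ∧ rk (B.D α) c = ξ then
                code B.lam (B.lev n Z h.choose) (restr f h.choose) else 0) (by
                intro ξ hξ
                split_ifs with h
                · exact code_lt hB.lam_regular.ord_pos
                    ((mem_lev.1 hf).2.2.1 _ h.choose_spec.2.1)
                · exact hB.lam_regular.ord_pos)
            refine ⟨β, fun _ => ⟨hβ, fun c hc hcα => ?_⟩⟩
            rw [← h _ (rk_lt hc hcα)]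
            have hx : ∃ d ∈ B.D α, d < α ∧ rk (B.D α) d = rk (B.D α) c := ⟨c, hc, hcα, rfl⟩
            rw [dif_pos hx, rk_injOn hx.choose_spec.1 hc hx.choose_spec.2.2]
          · exact ⟨0, fun h => absurd h hf⟩
        choose e he using hex
        refine mk_le_of_code e (fun f hf g hg hfg => ?_) fun f hf => (he f hf).1
        refine hB.eq_of_code_eq hα hl (mem_lev.1 hf).1 (mem_lev.1 hg).1 (mem_lev.1 hf).2.2.1
          (mem_lev.1 hg).2.2.1 ih' fun c hc hcα => ?_
        rw [(he f hf).2 c hc hcα, (he g hg).2 c hc hcα, hfg]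
    · by_cases h0 : α = 0
      · subst h0
        have hs : (B.lev n Z 0).Subsingleton := fun f hf g hg => funext fun ζ => by
          rw [(mem_lev.1 hf).1 ζ zero_le, (mem_lev.1 hg).1 ζ zero_le]
        exact (Cardinal.mk_le_one_iff_set_subsingleton.2 hs).trans
          (Cardinal.one_lt_aleph0.le.trans hinf)
      · obtain ⟨β, rfl⟩ : ∃ β, Order.succ β = α := by
          by_contra! hne
          exact hl ⟨fun hm => h0 hm.eq_bot, Order.isSuccPrelimit_of_succ_ne hne⟩
        have hβ := Order.lt_succ β
        have hinj : #(B.lev n Z (Order.succ β)) ≤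
            #(B.lev n Z β × Set.Iio (max B.lam.ord β)) := by
          refine Cardinal.mk_le_of_injective (f := fun f => (⟨restr f.1 β,
            (mem_lev.1 f.2).2.2.1 β hβ⟩, ⟨f.1 β, (mem_lev.1 f.2).2.1 β hβ⟩)) ?_
          rintro ⟨f, hf⟩ ⟨g, hg⟩ hfg
          simp only [Prod.mk.injEq, Subtype.mk.injEq] at hfg
          refine Subtype.ext (funext fun ζ => ?_)
          rcases lt_trichotomy ζ β with hζ | rfl | hζ
          · exact (restr_of_lt f hζ).symm.trans
              ((congrFun hfg.1 ζ).trans (restr_of_lt g hζ))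
          · exact congrArg Subtype.val hfg.2
          · exact ((mem_lev.1 hf).1 ζ (Order.succ_le_of_lt hζ)).trans
              ((mem_lev.1 hg).1 ζ (Order.succ_le_of_lt hζ)).symm
        refine hinj.trans ?_
        rw [Cardinal.mk_prod, Cardinal.lift_id, Cardinal.lift_id]
        exact (mul_le_mul' (ih' β hβ) (hB.mk_Iio_le (max_lt hB.lam_ord_lt (hβ.trans hα)))).trans
          (Cardinal.mul_eq_self hinf).le

/-- At most one branch of the tree below a limit height is omitted. -/
theorem eq_of_notMem_lev (hB : B.IsGood κ) {α : Ordinal.{u}} {f g : Fn.{u}} (hα : α < κ.ord)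
    (hl : Order.IsSuccLimit α) (hf0 : ∀ ζ, α ≤ ζ → f ζ = 0) (hg0 : ∀ ζ, α ≤ ζ → g ζ = 0)
    (hf : ∀ β < α, restr f β ∈ B.lev n Z β) (hg : ∀ β < α, restr g β ∈ B.lev n Z β)
    (hf' : f ∉ B.lev n Z α) (hg' : g ∉ B.lev n Z α) : f = g := by
  -- At a limit the other clauses are automatic, so an omitted branch is a guessed one, and the
  -- guess fixes all its codes.
  have key : ∀ f : Fn.{u}, (∀ ζ, α ≤ ζ → f ζ = 0) → (∀ β < α, restr f β ∈ B.lev n Z β) →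
      f ∉ B.lev n Z α → B.Guess n Z α f := by
    intro f hf0 hf hf'
    by_contra hgu
    refine hf' (mem_lev.2 ⟨hf0, fun ζ hζ => ?_, hf, fun _ h => absurd h hgu⟩)
    rw [← restr_of_lt f (Order.lt_succ ζ)]
    exact (mem_lev.1 (hf _ (hl.succ_lt hζ))).2.1 ζ (Order.lt_succ ζ)
  refine hB.eq_of_code_eq hα hl hf0 hg0 hf hg (fun β hβ => hB.mk_lev_le (hβ.trans hα))
    fun c hc hcα => ?_
  rw [(key f hf0 hf hf').2 c hc hcα, (key g hg0 hg hg').2 c hc hcα]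

/-! ### Passing through elements of antichains -/

theorem exists_lt_mem_of_mem_S (hB : B.IsGood κ) {α β : Ordinal.{u}} (hα : α ∈ B.S)
    (hβ : β < α) : ∃ c ∈ B.D α, β < c ∧ c < α := by
  obtain ⟨s, hs⟩ := hB.ladder.omega α hα
  obtain ⟨k, hk⟩ := hs.2.2 β hβ
  obtain ⟨c, hc, hle⟩ := hB.ladder.cofinal α (hB.ladder.lt α hα) _ (hs.2.1 k)
  exact ⟨c, hc, hk.trans_le hle, hB.ladder.below α (hB.ladder.lt α hα) c hc⟩

theorem jumpHeight_mem (hB : B.IsGood κ) (n : ℕ) {α η : Ordinal.{u}} (hα : α ∈ B.S)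
    (hη : η < α) : B.jumpHeight n α η ∈ start (B.D α) η ∧ B.jumpHeight n α η < α ∧
      n ≤ (B.D α ∩ Set.Iio (B.jumpHeight n α η)).ncard := by
  refine csInf_mem (s := {δ | δ ∈ start (B.D α) η ∧ δ < α ∧
    n ≤ (B.D α ∩ Set.Iio δ).ncard}) ?_
  suffices h : ∃ c ∈ B.D α, η < c ∧ c < α ∧ n ≤ (B.D α ∩ Set.Iio c).ncard by
    obtain ⟨c, h1, h2, h3, h4⟩ := h
    exact ⟨c, Or.inr ⟨h1, h2⟩, h3, h4⟩
  induction n with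
  | zero =>
    obtain ⟨c, h1, h2, h3⟩ := hB.exists_lt_mem_of_mem_S hα hη
    exact ⟨c, h1, h2, h3, Nat.zero_le _⟩
  | succ n ih =>
    obtain ⟨c, h1, h2, h3, h4⟩ := ih
    obtain ⟨d, h5, h6, h7⟩ := hB.exists_lt_mem_of_mem_S hα h3
    refine ⟨d, h5, h2.trans h6, h7, ?_⟩
    have hlt : (B.D α ∩ Set.Iio c).ncard < (B.D α ∩ Set.Iio d).ncard := by
      -- Finiteness of the ladder below `d` matters, as `ncard` vanishes on infinite sets.
      refine Set.ncard_lt_ncard ⟨fun a ha => ⟨ha.1, lt_trans ha.2 h6⟩, fun hsub => ?_⟩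
        (hB.ladder.finite α hα d h7)
      exact lt_irrefl c (hsub ⟨h1, h6⟩).2
    omega

/-- Canonical extensions pass through jumps at `γ`. -/
theorem exists_restr_jmp_eq (hB : B.IsGood κ) {γ β : Ordinal.{u}} (hγ : γ ∈ B.S)
    (hβ : β < κ.ord) (hγβ : γ ≤ β) :
    ∃ N : ℕ, ∀ n, N ≤ n → ∀ Z : Ordinal.{u} → Ordinal.{u} → Set Fn.{u}, ∀ η < γ,
      ∀ y ∈ B.lev n Z η, ∃ η' < γ, ∃ y' ∈ B.lev n Z η',
        restr (B.jmp n Z β η y) γ = B.jmp n Z γ η' y' := by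
  induction β using WellFoundedLT.induction with
  | ind β ih =>
    rcases hγβ.eq_or_lt with rfl | hlt
    · exact ⟨0, fun n _ Z η hη y hy =>
        ⟨η, hη, y, hy, restr_eq_of_mem_lev (hB.jmp_mem hβ hη hy)⟩⟩
    -- The first rung `b` at or above `γ` is the next step of the walk from `β` down to `γ`.
    have hne : {c | c ∈ B.D β ∧ γ ≤ c}.Nonempty := by
      obtain ⟨c, hc⟩ := hB.ladder.cofinal β hβ γ hlt
      exact ⟨c, hc⟩
    obtain ⟨hb1, hb2⟩ := csInf_mem hne
    have hmin : ∀ c ∈ B.D β, γ ≤ c → sInf {c | c ∈ B.D β ∧ γ ≤ c} ≤ c := fun c hc hle =>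
      csInf_le' ⟨hc, hle⟩
    set b := sInf {c | c ∈ B.D β ∧ γ ≤ c}
    have hbβ : b < β := hB.ladder.below β hβ b hb1
    obtain ⟨N, hN⟩ := ih b hbβ (hbβ.trans hβ) hb2
    -- The second bound is used only for `β ∈ S`, where the set is finite: it forces the jump height
    -- at `β` to be at least `γ`.
    refine ⟨max N ((B.D β ∩ Set.Iio γ).ncard + 1), fun n hn Z η hη y hy => ?_⟩
    have hηb : η < b := hη.trans_le hb2
    have hbY : b ∈ start (B.D β) η := Or.inr ⟨hb1, hηb⟩
    have hbp : ∃ p, IsPred (start (B.D β) η) p b := by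
      rcases isPred_or_isLim hηb hbβ.le (hB.ladder.closed β hβ) with h | h
      · exact h
      -- A limit point of `D β` is not the element `γ` of `S`, and beyond `γ` it would contradict
      -- minimality of `b`.
      · have hγb : γ < b := lt_of_le_of_ne hb2 fun he =>
          hB.ladder.notMem β hβ b hbβ h (he ▸ hγ)
        obtain ⟨d, hd, h1, h2⟩ := h.2 γ hγb
        exact absurd (hmin d hd h1.le) h2.not_ge
    obtain ⟨p, hp⟩ := hbp
    have hpγ : p < γ := by
      rcases hp.1 with h | h
      · rwa [h]
      · by_contra! hle
        exact absurd (hmin p h.1 hle) hp.2.1.not_ge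
    have hpm := hB.cpath_mem hβ hy (hp.2.1.trans hbβ) hp.1
    obtain ⟨η', hη', y', hy', he⟩ := hN n ((le_max_left _ _).trans hn) Z p hpγ _ hpm
    have hcb : B.cpath n Z β η y b = B.jmp n Z b p (B.cpath n Z β η y p) :=
      path_of_isPred hηb hp
    rw [← hcb] at he
    refine ⟨η', hη', y', hy', ?_⟩
    rw [← he]
    -- Even if a detour is made at `β`, it respects the canonical path up to a height of at least
    -- `b`.
    by_cases h : β ∈ B.S ∧ ∃ p, B.IsTarget n Z β η y p
    · obtain ⟨ε, w, ⟨h1, h2, h3, h4, -⟩, hj⟩ := exists_jmp h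
      obtain ⟨h5, h6, h7⟩ := hB.jumpHeight_mem n h.1 (hη.trans hlt)
      set δ := B.jumpHeight n β η
      have hγδ : γ ≤ δ := by
        by_contra! hδγ
        have := Set.ncard_le_ncard (s := B.D β ∩ Set.Iio δ) (t := B.D β ∩ Set.Iio γ)
          (fun a ha => ⟨ha.1, lt_trans ha.2 hδγ⟩) (hB.ladder.finite β h.1 γ hlt)
        have := (le_max_right _ _).trans hn
        omega
      have hbδ : b ≤ δ := by
        rcases h5 with h5 | h5
        · exact absurd (h5 ▸ hγδ) hη.not_ge
        · exact hmin δ h5.1 hγδ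
      have hw : restr w b = B.cpath n Z β η y b := by
        rw [← restr_restr _ hbδ, h4, hB.restr_cpath hβ hy h6 h5 hbY hbδ]
      rw [hj, ← hw, restr_restr _ hb2, ← restr_restr _ ((hb2.trans hbδ).trans h1),
        hB.restr_ext hβ h2 h3]
    · rw [jmp_of_not h, ← hB.restr_ext_eq_cpath hβ hy hbβ hbY, restr_restr _ hb2]

/-- A jump meets the antichain that is anticipated correctly. -/
theorem exists_restr_jmp_mem (hB : B.IsGood κ) {γ η : Ordinal.{u}} {y : Fn.{u}} (hγ : γ ∈ B.S)
    (hη : η < γ) (hy : y ∈ B.lev n Z η) (A : Ordinal.{u} → Set Fn.{u})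
    (hA : ∀ ε < γ, Z γ ε = A ε)
    (hd : ∀ δ < γ, ∀ w ∈ B.lev n Z δ, ∃ ε < γ, δ ≤ ε ∧ ∃ w' ∈ B.lev n Z ε, restr w' δ = w ∧
      ∃ ε' ≤ ε, restr w' ε' ∈ A ε') : ∃ ε < γ, restr (B.jmp n Z γ η y) ε ∈ A ε := by
  have hγκ := hB.ladder.lt γ hγ
  obtain ⟨h5, h6, -⟩ := hB.jumpHeight_mem n hγ hη
  have hm := hB.cpath_mem hγκ hy h6 h5
  have hηδ := le_of_mem_start h5
  obtain ⟨ε, hε, hδε, w, hw, hwδ, ε', hε', hmem⟩ := hd _ h6 _ hm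
  -- This shows only that targets exist; the one chosen by `jmp` may differ, but it too extends an
  -- element of the family.
  have ht : B.IsTarget n Z γ η y (ε, w) := by
    refine ⟨hδε, hε, hw, hwδ, hηδ.trans hδε, ?_, ε', hε', ?_⟩
    · rw [← restr_restr _ hηδ, hwδ, hB.restr_cpath hγκ hy h6 h5 (self_mem_start _ _) hηδ, cpath,
        path_of_le le_rfl]
    · rw [hA ε' (hε'.trans_lt hε)]; exact hmem
  obtain ⟨ε₁, w₁, ⟨-, h1, h2, -, -, -, ε₂, h3, h4⟩, hj⟩ := exists_jmp ⟨hγ, _, ht⟩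
  refine ⟨ε₂, h3.trans_lt h1, ?_⟩
  rw [hj, ← restr_restr _ h3, hB.restr_ext hγκ h1 h2, ← hA ε₂ (h3.trans_lt h1)]
  exact h4

end Blueprint.IsGood

/-! ### Predicting and sealing families of nodes -/

theorem lift_power_lift {κ lam : Cardinal.{u}} (hl : ℵ₀ ≤ lam) (hpow : κ = 2 ^ lam) :
    Cardinal.lift.{u + 1} κ ^ Cardinal.lift.{u + 1} lam = Cardinal.lift.{u + 1} κ := by
  rw [← Cardinal.lift_power, hpow, ← Cardinal.power_mul, Cardinal.mul_eq_self hl]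

/-- Functions of bounded support with values below `κ`. -/
abbrev BddFn (κ : Cardinal.{u}) : Type (u + 1) :=
  {f : Fn.{u} // ∃ ξ < κ.ord, (∀ ζ, ξ ≤ ζ → f ζ = 0) ∧ ∀ ζ, f ζ < κ.ord}

theorem mk_bddFn_le {κ lam : Cardinal.{u}} (hl : ℵ₀ ≤ lam) (hsucc : κ = Order.succ lam)
    (hpow : κ = 2 ^ lam) : #(BddFn κ) ≤ Cardinal.lift.{u + 1} κ := by
  have hκ : ℵ₀ ≤ Cardinal.lift.{u + 1} κ :=
    Cardinal.aleph0_le_lift.2 (hl.trans (hsucc ▸ Order.le_succ lam))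
  have hmk : #(Set.Iio κ.ord) = Cardinal.lift.{u + 1} κ := by
    rw [Cardinal.mk_Iio_ordinal, Cardinal.card_ord]
  have hsub : {f : Fn.{u} | ∃ ξ < κ.ord, (∀ ζ, ξ ≤ ζ → f ζ = 0) ∧ ∀ ζ, f ζ < κ.ord} ⊆
      ⋃ ξ : Set.Iio κ.ord, {f : Fn.{u} | (∀ ζ, ξ.1 ≤ ζ → f ζ = 0) ∧ ∀ ζ, f ζ < κ.ord} := by
    rintro f ⟨ξ, hξ, h⟩
    exact Set.mem_iUnion.2 ⟨⟨ξ, hξ⟩, h⟩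
  have hone : ∀ ξ : Set.Iio κ.ord,
      #{f : Fn.{u} | (∀ ζ, ξ.1 ≤ ζ → f ζ = 0) ∧ ∀ ζ, f ζ < κ.ord} ≤
        Cardinal.lift.{u + 1} κ := by
    intro ξ
    have h1 : #{f : Fn.{u} | (∀ ζ, ξ.1 ≤ ζ → f ζ = 0) ∧ ∀ ζ, f ζ < κ.ord} ≤
        #(Set.Iio ξ.1 → Set.Iio κ.ord) := by
      refine Cardinal.mk_le_of_injective (f := fun f ζ => ⟨f.1 ζ.1, f.2.2 ζ.1⟩) ?_
      rintro ⟨f, hf⟩ ⟨g, hg⟩ hfg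
      refine Subtype.ext (funext fun ζ => ?_)
      by_cases hζ : ζ < ξ.1
      · exact congrArg Subtype.val (congrFun hfg ⟨ζ, hζ⟩)
      · exact (hf.1 ζ (not_lt.1 hζ)).trans (hg.1 ζ (not_lt.1 hζ)).symm
    refine h1.trans ?_
    rw [Cardinal.mk_pi, Cardinal.prod_const', hmk]
    refine (Cardinal.power_le_power_left (Cardinal.aleph0_pos.trans_le hκ).ne' ?_).trans
      (lift_power_lift hl hpow).le
    rw [Cardinal.mk_Iio_ordinal, Cardinal.lift_le]
    exact Order.lt_succ_iff.1 (hsucc ▸ Cardinal.lt_ord.1 ξ.2)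
  refine (Cardinal.mk_le_mk_of_subset hsub).trans (Cardinal.mk_iUnion_le_sum_mk.trans ?_)
  refine (Cardinal.sum_le_sum _ (fun _ => Cardinal.lift.{u + 1} κ) hone).trans ?_
  rw [Cardinal.sum_const', hmk]
  exact (Cardinal.mul_eq_self hκ).le

/-- A quadruple `(i, n, ε, f)` says that `f` belongs to the set with index `(i, n, ε)`. -/
abbrev Entry (κ lam : Cardinal.{u}) : Type (u + 1) :=
  Set.Iio lam.ord × ℕ × Set.Iio κ.ord × BddFn κ

/-- There are `κ` entries, and `κ ^ lam = (2 ^ lam) ^ lam = κ`. -/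
theorem exists_enumeration {κ lam : Cardinal.{u}} (hl : ℵ₀ ≤ lam) (hsucc : κ = Order.succ lam)
    (hpow : κ = 2 ^ lam) : ∃ d : Ordinal.{u} → Set (Entry κ lam),
      ∀ P : Set (Entry κ lam), #P ≤ Cardinal.lift.{u + 1} lam → ∃ j < κ.ord, d j = P := by
  classical
  have hlk : lam ≤ κ := hsucc ▸ Order.le_succ lam
  have hκ : ℵ₀ ≤ Cardinal.lift.{u + 1} κ := Cardinal.aleph0_le_lift.2 (hl.trans hlk)
  have hmk : #(Set.Iio κ.ord) = Cardinal.lift.{u + 1} κ := by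
    rw [Cardinal.mk_Iio_ordinal, Cardinal.card_ord]
  have hE : #(Entry κ lam) ≤ Cardinal.lift.{u + 1} κ := by
    simp only [Entry, Cardinal.mk_prod, Cardinal.lift_id, Cardinal.lift_id', Cardinal.mk_nat,
      Cardinal.lift_aleph0]
    refine Cardinal.mul_le_of_le hκ ?_ (Cardinal.mul_le_of_le hκ hκ
      (Cardinal.mul_le_of_le hκ hmk.le (mk_bddFn_le hl hsucc hpow)))
    rw [Cardinal.mk_Iio_ordinal, Cardinal.card_ord, Cardinal.lift_le]
    exact hlk
  have hS : #{P : Set (Entry κ lam) // #P ≤ Cardinal.lift.{u + 1} lam} ≤ #(Set.Iio κ.ord) := by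
    rw [hmk]
    refine (Cardinal.mk_bounded_set_le _ _).trans ?_
    exact (Cardinal.power_le_power_right (max_le hE hκ)).trans (lift_power_lift hl hpow).le
  obtain ⟨g⟩ := (Cardinal.le_def _ _).1 hS
  refine ⟨fun j => if h : ∃ P, (g P).1 = j then h.choose.1 else ∅, fun P hP => ?_⟩
  refine ⟨(g ⟨P, hP⟩).1, (g ⟨P, hP⟩).2, ?_⟩
  have h : ∃ Q, (g Q).1 = (g ⟨P, hP⟩).1 := ⟨_, rfl⟩
  refine (dif_pos h).trans ?_
  rw [g.injective (Subtype.ext h.choose_spec)]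

/-- Every node has an extension that extends an element of `A`. -/
def Blueprint.IsPredense (B : Blueprint.{u}) (κ : Cardinal.{u}) (n : ℕ)
    (Z : Ordinal.{u} → Ordinal.{u} → Set Fn.{u}) (A : Ordinal.{u} → Set Fn.{u}) : Prop :=
  ∀ δ < κ.ord, ∀ w ∈ B.lev n Z δ, ∃ ε < κ.ord, δ ≤ ε ∧ ∃ w' ∈ B.lev n Z ε, restr w' δ = w ∧
    ∃ ε' ≤ ε, restr w' ε' ∈ A ε'

namespace Blueprint.IsGood

variable {B : Blueprint.{u}} {κ : Cardinal.{u}} {n : ℕ}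
  {Z : Ordinal.{u} → Ordinal.{u} → Set Fn.{u}}

/-- At `δ ∈ S` the family below `δ` is a union of `ω` many initial parts, whose indices in the
enumeration `d` lie below `δ` by closure. A map from `lam` onto `δ` turns these indices into an
`ω`-sequence in `lam`, which the diamond sequence lists as some `F i`. This `i` is the correct
candidate at `δ`. -/
theorem exists_prediction (hB : B.IsGood κ) (hpow : κ = 2 ^ B.lam) :
    ∃ Z : Ordinal.{u} → ℕ → Ordinal.{u} → Ordinal.{u} → Set Fn.{u},
      ∀ A : Ordinal.{u} → ℕ → Ordinal.{u} → Set Fn.{u},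
        (∀ i < B.lam.ord, ∀ n, ∀ ε < κ.ord, #(A i n ε) ≤ Cardinal.lift.{u + 1} B.lam ∧
          ∀ f ∈ A i n ε, (∀ ζ, ε ≤ ζ → f ζ = 0) ∧ ∀ ζ, f ζ < κ.ord) →
        ∀ h : Ordinal.{u} → Ordinal.{u}, (∀ ξ < κ.ord, h ξ < κ.ord) →
          ∃ δ ∈ B.S, (∀ ξ < δ, h ξ < δ) ∧
            ∃ i < B.lam.ord, ∀ n, ∀ ε < δ, Z i n δ ε = A i n ε := by
  have hinf : ℵ₀ ≤ Cardinal.lift.{u + 1} B.lam := Cardinal.aleph0_le_lift.2 hB.lam_unc.le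
  obtain ⟨d, hd⟩ := exists_enumeration hB.lam_unc.le hB.succ_eq hpow
  have hex : ∀ c : Ordinal.{u}, ∃ e : Ordinal.{u} → Ordinal.{u}, c < κ.ord →
      ∀ j < c, ∃ ξ < B.lam.ord, e ξ = j := by
    classical
    intro c
    by_cases hc : c < κ.ord
    · have hle : #(Set.Iio c) ≤ #(Set.Iio B.lam.ord) := by
        rw [Cardinal.mk_Iio_ordinal B.lam.ord, Cardinal.card_ord]
        exact hB.mk_Iio_le hc
      obtain ⟨g⟩ := (Cardinal.le_def _ _).1 hle
      refine ⟨fun ξ => if h : ∃ j, (g j).1 = ξ then h.choose.1 else 0, fun _ j hj =>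
        ⟨(g ⟨j, hj⟩).1, (g ⟨j, hj⟩).2, ?_⟩⟩
      have h : ∃ k, (g k).1 = (g ⟨j, hj⟩).1 := ⟨_, rfl⟩
      refine (dif_pos h).trans ?_
      rw [g.injective (Subtype.ext h.choose_spec)]
    · exact ⟨id, fun h => absurd h hc⟩
  choose e he using hex
  -- The decoding index `i` also selects the coordinate: candidate `i` only has to predict the
  -- families `A i n`.
  refine ⟨fun i n c ε => {f | ∃ k : ℕ, ∃ w ∈ d (e c (B.F i k)),
    w.1.1 = i ∧ w.2.1 = n ∧ w.2.2.1.1 = ε ∧ w.2.2.2.1 = f}, fun A hA h hh => ?_⟩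
  set fam : Ordinal.{u} → Set (Entry κ B.lam) := fun ξ =>
    {w | w.2.2.1.1 < ξ ∧ w.2.2.2.1 ∈ A w.1.1 w.2.1 w.2.2.1.1} with hfam
  have hcard : ∀ ξ < κ.ord, #(fam ξ) ≤ Cardinal.lift.{u + 1} B.lam := by
    intro ξ hξ
    have hsub : fam ξ ⊆ ⋃ q : Set.Iio B.lam.ord × ℕ × Set.Iio ξ,
        {w | w.1 = q.1 ∧ w.2.1 = q.2.1 ∧ w.2.2.1.1 = q.2.2.1 ∧
          w.2.2.2.1 ∈ A q.1.1 q.2.1 q.2.2.1} := by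
      rintro w ⟨h1, h2⟩
      exact Set.mem_iUnion.2 ⟨(w.1, w.2.1, ⟨w.2.2.1.1, h1⟩), rfl, rfl, rfl, h2⟩
    refine (Cardinal.mk_le_mk_of_subset hsub).trans (Cardinal.mk_iUnion_le_sum_mk.trans ?_)
    refine (Cardinal.sum_le_sum _ (fun _ => Cardinal.lift.{u + 1} B.lam) fun q => ?_).trans ?_
    · refine le_trans ?_ (hA q.1.1 q.1.2 q.2.1 q.2.2.1 (lt_trans q.2.2.2 hξ)).1
      refine Cardinal.mk_le_of_injective (f := fun w => ⟨w.1.2.2.2.1, w.2.2.2.2⟩) ?_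
      rintro ⟨⟨a, b, c, f⟩, h1, h2, h3, h4⟩ ⟨⟨a', b', c', f'⟩, h1', h2', h3', h4'⟩ hw
      simp only [Subtype.mk.injEq] at hw h1 h2 h3 h1' h2' h3'
      obtain rfl := h1.trans h1'.symm
      obtain rfl := h2.trans h2'.symm
      obtain rfl := Subtype.ext (h3.trans h3'.symm)
      obtain rfl := Subtype.ext hw
      rfl
    · rw [Cardinal.sum_const']
      refine Cardinal.mul_le_of_le hinf ?_ le_rfl
      simp only [Cardinal.mk_prod, Cardinal.lift_id, Cardinal.lift_id', Cardinal.mk_nat,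
        Cardinal.lift_aleph0]
      refine Cardinal.mul_le_of_le hinf ?_ (Cardinal.mul_le_of_le hinf hinf (hB.mk_Iio_le hξ))
      rw [Cardinal.mk_Iio_ordinal, Cardinal.card_ord]
  have hj : ∀ ξ : Ordinal.{u}, ∃ j < κ.ord, ξ < κ.ord → d j = fam ξ := by
    intro ξ
    by_cases hξ : ξ < κ.ord
    · obtain ⟨j, h1, h2⟩ := hd (fam ξ) (hcard ξ hξ)
      exact ⟨j, h1, fun _ => h2⟩
    · exact ⟨0, hB.regular.ord_pos, fun h => absurd h hξ⟩
  choose j hj1 hj2 using hj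
  obtain ⟨δ, hδ, hcl⟩ := hB.ladder.stationary (fun ξ => max (h ξ) (j ξ))
    fun ξ hξ => max_lt (hh ξ hξ) (hj1 ξ)
  have hδκ := hB.ladder.lt δ hδ
  obtain ⟨s, hs⟩ := hB.ladder.omega δ hδ
  have hρ : ∀ k : ℕ, ∃ ξ < B.lam.ord, e δ ξ = j (s k) := fun k =>
    he δ hδκ _ ((le_max_right _ _).trans_lt (hcl _ (hs.2.1 k)))
  choose ρ hρ1 hρ2 using hρ
  have hω : ω < B.lam.ord := by
    rw [← Cardinal.ord_aleph0]; exact Cardinal.ord_lt_ord.2 hB.lam_unc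
  obtain ⟨i, hi, hF⟩ := hB.exists_F_eq hω
    (fun ξ => open Classical in if h : ∃ k : ℕ, (k : Ordinal.{u}) = ξ then ρ h.choose else 0) (by
      intro ξ _
      split_ifs with h
      · exact hρ1 _
      · exact hB.lam_regular.ord_pos)
  have hF' : ∀ k : ℕ, e δ (B.F i k) = j (s k) := by
    intro k
    have h : ∃ k' : ℕ, (k' : Ordinal.{u}) = k := ⟨k, rfl⟩
    rw [← hF k (Ordinal.natCast_lt_omega0 k), dif_pos h,
      Nat.cast_injective (R := Ordinal) h.choose_spec, hρ2]
  refine ⟨δ, hδ, fun ξ hξ => (le_max_left _ _).trans_lt (hcl ξ hξ), i, hi, fun n ε hε => ?_⟩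
  ext f
  constructor
  · rintro ⟨k, w, hw, rfl, rfl, rfl, rfl⟩
    rw [hF', hj2 _ ((hs.2.1 k).trans hδκ)] at hw
    exact hw.2
  · intro hf
    obtain ⟨k, hk⟩ := hs.2.2 ε hε
    have hεκ := hε.trans hδκ
    have hfb := (hA i hi n ε hεκ).2 f hf
    refine ⟨k, (⟨i, hi⟩, n, ⟨ε, hεκ⟩, ⟨f, ε, hεκ, hfb⟩), ?_, rfl, rfl, rfl, rfl⟩
    rw [hF', hj2 _ ((hs.2.1 k).trans hδκ)]
    exact ⟨hk, hf⟩

theorem exists_bound_lev (hB : B.IsGood κ) {δ : Ordinal.{u}} (hδ : δ < κ.ord)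
    (g : Fn.{u} → Ordinal.{u}) (hg : ∀ w ∈ B.lev n Z δ, g w < κ.ord) :
    ∃ υ < κ.ord, ∀ w ∈ B.lev n Z δ, g w < υ := by
  classical
  obtain ⟨υ, hυ, h⟩ := exists_bound hB.regular hB.lam_ord_lt
    (fun ξ => if h : ∃ w ∈ B.lev n Z δ, code B.lam (B.lev n Z δ) w = ξ then g h.choose else 0) (by
      intro ξ _
      split_ifs with h
      · exact hg _ h.choose_spec.1
      · exact hB.regular.ord_pos)
  refine ⟨υ, hυ, fun w hw => ?_⟩
  have := h _ (code_lt hB.lam_regular.ord_pos hw)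
  have hx : ∃ w' ∈ B.lev n Z δ, code B.lam (B.lev n Z δ) w' = code B.lam (B.lev n Z δ) w :=
    ⟨w, hw, rfl⟩
  rwa [dif_pos hx, code_injOn (hB.mk_lev_le hδ) hx.choose_spec.1 hw hx.choose_spec.2] at this

/-- A level has at most `lam` nodes, so the heights that witness predensity over it are bounded
below `κ`. -/
theorem exists_closure (hB : B.IsGood κ) {A : Ordinal.{u} → Set Fn.{u}}
    (hA : B.IsPredense κ n Z A) : ∃ h : Ordinal.{u} → Ordinal.{u}, (∀ ξ < κ.ord, h ξ < κ.ord) ∧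
      ∀ δ < κ.ord, ∀ w ∈ B.lev n Z δ, ∃ ε < h δ, δ ≤ ε ∧ ∃ w' ∈ B.lev n Z ε, restr w' δ = w ∧
        ∃ ε' ≤ ε, restr w' ε' ∈ A ε' := by
  have : ∀ δ : Ordinal.{u}, ∃ υ, δ < κ.ord → υ < κ.ord ∧ ∀ w ∈ B.lev n Z δ, ∃ ε < υ, δ ≤ ε ∧
      ∃ w' ∈ B.lev n Z ε, restr w' δ = w ∧ ∃ ε' ≤ ε, restr w' ε' ∈ A ε' := by
    intro δ
    by_cases hδ : δ < κ.ord
    · have h1 : ∀ w : Fn.{u}, ∃ ε, w ∈ B.lev n Z δ → ε < κ.ord ∧ δ ≤ ε ∧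
          ∃ w' ∈ B.lev n Z ε, restr w' δ = w ∧ ∃ ε' ≤ ε, restr w' ε' ∈ A ε' := by
        intro w
        by_cases hw : w ∈ B.lev n Z δ
        · obtain ⟨ε, h⟩ := hA δ hδ w hw
          exact ⟨ε, fun _ => h⟩
        · exact ⟨0, fun h => absurd h hw⟩
      choose g hg using h1
      obtain ⟨υ, hυ, h⟩ := hB.exists_bound_lev hδ g fun w hw => (hg w hw).1
      exact ⟨υ, fun _ => ⟨hυ, fun w hw => ⟨g w, h w hw, (hg w hw).2⟩⟩⟩
    · exact ⟨0, fun h => absurd h hδ⟩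
  choose h hh using this
  exact ⟨h, fun ξ hξ => (hh ξ hξ).1, fun δ hδ => (hh δ hδ).2⟩

theorem exists_sealed (hB : B.IsGood κ) (hpow : κ = 2 ^ B.lam) : ∃ n Z,
    ∀ A : Ordinal.{u} → Set Fn.{u}, (∀ ε, A ε ⊆ B.lev n Z ε) → B.IsPredense κ n Z A →
      ∃ α < κ.ord, ∀ t ∈ B.lev n Z α, ∃ ε < α, restr t ε ∈ A ε := by
  obtain ⟨Z, hZ⟩ := hB.exists_prediction hpow
  by_contra! hne
  -- One counterexample for each candidate `i` and each delay `n`; all of them are predicted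
  -- together.
  choose A hA1 hA2 hA3 using fun (i : Ordinal.{u}) (n : ℕ) => hne n (Z i n)
  choose H₀ hH₀ hH₀' using fun i n => hB.exists_closure (hA2 i n)
  have hH : ∀ ξ : Ordinal.{u}, ∃ υ < κ.ord, ξ < κ.ord → ∀ i < B.lam.ord, ∀ n, H₀ i n ξ ≤ υ := by
    intro ξ
    by_cases hξ : ξ < κ.ord
    · choose υ hυ hυ' using fun i =>
        exists_bound_nat hB.regular hB.unc (fun n => H₀ i n ξ) fun n => hH₀ i n ξ hξ
      obtain ⟨τ, hτ, hτ'⟩ := exists_bound hB.regular hB.lam_ord_lt υ fun i _ => hυ i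
      exact ⟨τ, hτ, fun _ i hi n => ((hυ' i n).trans (hτ' i hi)).le⟩
    · exact ⟨0, hB.regular.ord_pos, fun h => absurd h hξ⟩
  choose H hH1 hH2 using hH
  have hAok : ∀ i < B.lam.ord, ∀ n, ∀ ε < κ.ord, #(A i n ε) ≤ Cardinal.lift.{u + 1} B.lam ∧
      ∀ f ∈ A i n ε, (∀ ζ, ε ≤ ζ → f ζ = 0) ∧ ∀ ζ, f ζ < κ.ord := by
    intro i hi n ε hε
    refine ⟨(Cardinal.mk_le_mk_of_subset (hA1 i n ε)).trans (hB.mk_lev_le hε), fun f hf => ?_⟩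
    have hm := mem_lev.1 (hA1 i n ε hf)
    refine ⟨hm.1, fun ζ => ?_⟩
    by_cases hζ : ζ < ε
    · exact (hm.2.1 ζ hζ).trans (max_lt hB.lam_ord_lt (hζ.trans hε))
    · rw [hm.1 ζ (not_lt.1 hζ)]
      exact hB.regular.ord_pos
  let G : Ordinal.{u} → Set Ordinal.{u} := fun i =>
    {γ | γ ∈ B.S ∧ (∀ ξ < γ, H ξ < γ) ∧ ∀ n, ∀ ε < γ, Z i n γ ε = A i n ε}
  -- Bounds for all the `G i` would have a common bound `τ < κ`, but some candidate is correct at a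
  -- suitable height beyond `τ`.
  have hG : ∃ i < B.lam.ord, ∀ υ < κ.ord, ∃ γ ∈ G i, υ < γ := by
    by_contra! hcon
    have : ∀ i : Ordinal.{u}, ∃ υ < κ.ord, i < B.lam.ord → ∀ γ ∈ G i, γ ≤ υ := by
      intro i
      by_cases hi : i < B.lam.ord
      · obtain ⟨υ, h1, h2⟩ := hcon i hi
        exact ⟨υ, h1, fun _ => h2⟩
      · exact ⟨0, hB.regular.ord_pos, fun h => absurd h hi⟩
    choose υ hυ1 hυ2 using this
    obtain ⟨τ, hτ, hτ'⟩ := exists_bound hB.regular hB.lam_ord_lt υ fun i _ => hυ1 i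
    obtain ⟨δ, hδ, hcl, i, hi, hZi⟩ := hZ A hAok (fun ξ => max (H ξ) τ)
      fun ξ _ => max_lt (hH1 ξ) hτ
    have hδG : δ ∈ G i := ⟨hδ, fun ξ hξ => (le_max_left _ _).trans_lt (hcl ξ hξ), hZi⟩
    obtain ⟨s, hs⟩ := hB.ladder.omega δ hδ
    have h1 := (le_max_right _ _).trans_lt (hcl _ (hs.2.1 0))
    exact absurd ((hυ2 i hi δ hδG).trans_lt (hτ' i hi)) h1.not_gt
  obtain ⟨i, hi, hG⟩ := hG
  have hnext : ∀ ξ : Ordinal.{u}, ∃ γ, ξ < κ.ord → γ ∈ G i ∧ ξ < γ := by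
    intro ξ
    by_cases hξ : ξ < κ.ord
    · obtain ⟨γ, h⟩ := hG ξ hξ
      exact ⟨γ, fun _ => h⟩
    · exact ⟨0, fun h => absurd h hξ⟩
  choose g hg using hnext
  have hcof : ∀ α < κ.ord, ∀ β < α, ∃ c ∈ B.D α, c < α ∧ β ≤ c := fun α hα β hβ =>
    let ⟨c, hc, hle⟩ := hB.ladder.cofinal α hα β hβ
    ⟨c, hc, hB.ladder.below α hα c hc, hle⟩
  obtain ⟨α, hα, hαl, hr, hαg⟩ := exists_closed_rk_eq hB.regular hB.lam_regular hB.lam_lt B.D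
    hcof hB.ladder.rank_le g fun ξ hξ => hB.ladder.lt _ (hg ξ hξ).1.1
  have hαS : α ∉ B.S := fun hS => by
    obtain ⟨s, hs⟩ := hB.ladder.omega α hS
    exact absurd hr (rk_lt_of_omegaSeq hB.lam_regular hB.lam_unc (hcof α hα)
      (hB.ladder.rank_le α hα hαl) hs).ne
  have hN : ∀ γ : Ordinal.{u}, ∃ N : ℕ, γ ∈ B.S → γ ≤ α → ∀ n, N ≤ n →
      ∀ Z : Ordinal.{u} → Ordinal.{u} → Set Fn.{u}, ∀ η < γ, ∀ y ∈ B.lev n Z η, ∃ η' < γ,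
        ∃ y' ∈ B.lev n Z η', restr (B.jmp n Z α η y) γ = B.jmp n Z γ η' y' := by
    intro γ
    by_cases h : γ ∈ B.S ∧ γ ≤ α
    · obtain ⟨N, hN⟩ := hB.exists_restr_jmp_eq h.1 hα h.2
      exact ⟨N, fun _ _ => hN⟩
    · exact ⟨0, fun h1 h2 => absurd ⟨h1, h2⟩ h⟩
  choose N hN using hN
  -- If each `n` failed beyond some `s n`, these ordinals would be bounded by a rung `c < α`. The
  -- next element `g c` of `G i` is below `α`, and the delay `N (g c)` refutes the failure.
  have hn : ∃ n : ℕ, ∀ ξ < α, ∃ γ ∈ G i, ξ < γ ∧ γ < α ∧ N γ ≤ n := by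
    by_contra! hcon
    choose s hs hs' using hcon
    obtain ⟨c, -, hcα, hc⟩ :=
      exists_bound_of_rk_eq hB.lam_regular hB.lam_unc (hcof α hα) hr s hs
    obtain ⟨h1, h2⟩ := hg c (hcα.trans hα)
    exact lt_irrefl _ (hs' _ _ h1 ((hc (N (g c))).trans_lt h2) (hαg c hcα))
  obtain ⟨n, hn⟩ := hn
  obtain ⟨t, ht, ht'⟩ := hA3 i n α hα
  -- The unsealed node `t` is canonical from some `η`, so it passes through a jump at a height `γ >
  -- η` of correct prediction.
  obtain ⟨η, hη, he⟩ := hB.exists_ext_eq hα hαl hr (mem_lev.1 ht).1 (mem_lev.1 ht).2.2.1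
  obtain ⟨γ, ⟨hγS, hγH, hγZ⟩, hηγ, hγα, hNγ⟩ := hn η hη
  obtain ⟨η', hη', y', hy', hj⟩ := hN γ hγS hγα.le n hNγ (Z i n) η hηγ _
    ((mem_lev.1 ht).2.2.1 η hη)
  rw [jmp_of_notMem hαS, he] at hj
  obtain ⟨ε, hε, hmem⟩ := hB.exists_restr_jmp_mem hγS hη' hy' (A i n) (hγZ n) (by
    intro δ hδ w hw
    obtain ⟨ε, hε, h⟩ := hH₀' i n δ (hδ.trans (hγα.trans hα)) w hw
    exact ⟨ε, hε.trans_le ((hH2 δ (hδ.trans (hγα.trans hα)) i hi n).trans (hγH δ hδ).le), h⟩)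
  rw [← hj, restr_restr _ hε.le] at hmem
  exact ht' ε (hε.trans hγα) hmem

end Blueprint.IsGood

/-! ### Streamlined trees as posets -/

theorem OrdSeq.ext_of_val {s t : OrdSeq.{u}} (h : s.length = t.length)
    (hv : ∀ ζ (h₁ : ζ < s.length) (h₂ : ζ < t.length), s.val ⟨ζ, h₁⟩ = t.val ⟨ζ, h₂⟩) : s = t := by
  obtain ⟨a, f⟩ := s
  obtain ⟨b, g⟩ := t
  obtain rfl : a = b := h
  congr
  exact funext fun i => hv i.1 i.2 i.2

theorem OrdSeq.restrict_le (t : OrdSeq.{u}) (α : Ordinal.{u}) : t.restrict α ≤ t :=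
  ⟨min_le_left _ _, fun _ => rfl⟩

theorem OrdSeq.eq_of_le_of_length_eq {s t : OrdSeq.{u}} (h : s ≤ t) (hl : s.length = t.length) :
    s = t :=
  OrdSeq.ext_of_val hl fun ζ hζ _ => h.2 ⟨ζ, hζ⟩

theorem OrdSeq.length_lt {s t : OrdSeq.{u}} (h : s < t) : s.length < t.length :=
  lt_of_le_of_ne h.le.1 fun he => h.ne (OrdSeq.eq_of_le_of_length_eq h.le he)

theorem OrdSeq.le_of_le_of_length_le {r s t : OrdSeq.{u}} (hr : r ≤ t) (hs : s ≤ t)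
    (hl : r.length ≤ s.length) : r ≤ s :=
  ⟨hl, fun i => (hr.2 i).trans (hs.2 ⟨i.1, i.2.trans_le hl⟩).symm⟩

theorem ordinal_eq_of_orderIso {α β : Ordinal.{u}} (e : Set.Iio α ≃o Set.Iio β) : α = β := by
  have h : Ordinal.type (fun a b : Set.Iio α => a < b) =
      Ordinal.type (fun a b : Set.Iio β => a < b) := Ordinal.type_eq.2 ⟨e.toRelIsoLT⟩
  have h' : Ordinal.lift.{u + 1} α = Ordinal.lift.{u + 1} β :=
    (Ordinal.type_lt_Iio α).symm.trans (h.trans (Ordinal.type_lt_Iio β))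
  exact Ordinal.lift_inj.1 h'

namespace IsStreamlined

variable {κ : Cardinal.{u}} {T : Set OrdSeq.{u}}

theorem le_iff (x y z : T) (hx : x ≤ z) (hy : y ≤ z) :
    x.1.length ≤ y.1.length ↔ x ≤ y :=
  ⟨fun h => OrdSeq.le_of_le_of_length_le (t := z.1) hx hy h, fun h => h.1⟩

/-- The predecessors of a node are its restrictions. -/
theorem hasHeight_length (hT : IsStreamlined κ T) (x : T) : HasHeight x x.1.length := by
  let e : Set.Iio x ↪o Set.Iio x.1.length := OrderEmbedding.ofMapLEIff
    (fun y => ⟨y.1.1.length, OrdSeq.length_lt (t := x.1) y.2⟩)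
    fun y z => le_iff y.1 z.1 x (le_of_lt y.2) (le_of_lt z.2)
  refine ⟨RelIso.ofSurjective e ?_⟩
  rintro ⟨ζ, hζ⟩
  have hl : (x.1.restrict ζ).length = ζ := min_eq_right (le_of_lt hζ)
  refine ⟨⟨⟨x.1.restrict ζ, hT.restrict_mem _ x.2 ζ (lt_trans hζ (hT.subset x.2).1)⟩, ?_⟩,
    Subtype.ext hl⟩
  refine lt_of_le_of_ne (OrdSeq.restrict_le x.1 ζ) fun he => ?_
  have := congrArg OrdSeq.length he
  exact absurd (this.symm.trans hl) (ne_of_gt hζ)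

theorem hasHeight_iff (hT : IsStreamlined κ T) (x : T) (α : Ordinal.{u}) :
    HasHeight x α ↔ x.1.length = α := by
  constructor
  · rintro ⟨e⟩
    obtain ⟨e'⟩ := hT.hasHeight_length x
    exact ordinal_eq_of_orderIso (e'.symm.trans e)
  · rintro rfl
    exact hT.hasHeight_length x

theorem isKTree (hT : IsStreamlined κ T) : IsKTree T κ where
  wellOrdered x := by
    obtain ⟨e⟩ := hT.hasHeight_length x
    exact (e.toRelIsoLT.toRelEmbedding).isWellOrder
  level_nonempty α hα := by
    obtain ⟨t, ht, hl⟩ := hT.level_nonempty α hα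
    exact ⟨⟨t, ht⟩, (hT.hasHeight_iff _ _).2 hl⟩
  level_card α hα := by
    have h : #(treeLevel T α) ≤ #(seqLevel T α) :=
      Cardinal.mk_le_of_injective
        (f := fun x => ⟨x.1.1, x.1.2, (hT.hasHeight_iff _ _).1 x.2⟩)
        fun x y hxy => Subtype.ext (Subtype.ext (congrArg (fun z : seqLevel T α => z.1) hxy))
    rw [Cardinal.lift_id'.{u, u + 1}]
    exact h.trans_lt (hT.level_card α hα)
  level_top := by
    refine Set.eq_empty_of_forall_notMem fun x hx => ?_
    have h1 := (hT.hasHeight_iff _ _).1 hx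
    have h2 := (hT.subset x.2).1
    exact absurd h1 h2.ne

end IsStreamlined

/-! ### The streamlined tree of a blueprint -/

/-- The node of height `α` given by `f`. -/
def toSeq (α : Ordinal.{u}) (f : Fn.{u}) : OrdSeq.{u} where
  length := α
  val i := (f i.1).toZFSet

theorem toSeq_le {α β : Ordinal.{u}} {f g : Fn.{u}} (hf : ∀ ζ, α ≤ ζ → f ζ = 0) :
    toSeq α f ≤ toSeq β g ↔ α ≤ β ∧ restr g α = f := by
  constructor
  · rintro ⟨h1, h2⟩
    refine ⟨h1, funext fun ζ => ?_⟩
    by_cases hζ : ζ < α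
    · rw [restr_of_lt _ hζ]
      exact (Ordinal.toZFSet_injective (h2 ⟨ζ, hζ⟩)).symm
    · rw [restr_of_le _ (not_lt.1 hζ), hf ζ (not_lt.1 hζ)]
  · rintro ⟨h1, rfl⟩
    exact ⟨h1, fun i => congrArg Ordinal.toZFSet (restr_of_lt g i.2)⟩

theorem toSeq_restrict {α β : Ordinal.{u}} (f : Fn.{u}) (h : β ≤ α) :
    (toSeq α f).restrict β = toSeq β (restr f β) :=
  OrdSeq.ext_of_val (min_eq_right h) fun _ _ hζ =>
    congrArg Ordinal.toZFSet (restr_of_lt f hζ).symm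

theorem toSeq_concat (α : Ordinal.{u}) (f : Fn.{u}) (i : Ordinal.{u}) :
    (toSeq α f).concat i.toZFSet = toSeq (Order.succ α) (Function.update f α i) := by
  refine OrdSeq.ext_of_val rfl fun ζ h1 h2 => ?_
  by_cases hζ : ζ < α
  · refine (dif_pos hζ).trans ?_
    exact congrArg Ordinal.toZFSet (Function.update_of_ne hζ.ne i f).symm
  · obtain rfl : ζ = α := le_antisymm (Order.lt_succ_iff.1 h2) (not_lt.1 hζ)
    refine (dif_neg hζ).trans ?_
    exact congrArg Ordinal.toZFSet (Function.update_self ζ i f).symm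

namespace Blueprint

/-- The tree as a set of sequences. -/
def seqTree (B : Blueprint.{u}) (κ : Cardinal.{u}) (n : ℕ)
    (Z : Ordinal.{u} → Ordinal.{u} → Set Fn.{u}) : Set OrdSeq.{u} :=
  {s | ∃ α < κ.ord, ∃ f ∈ B.lev n Z α, s = toSeq α f}

variable {B : Blueprint.{u}} {κ : Cardinal.{u}} {n : ℕ}
  {Z : Ordinal.{u} → Ordinal.{u} → Set Fn.{u}}

theorem exists_of_mem_seqTree {s : OrdSeq.{u}} (hs : s ∈ B.seqTree κ n Z) :
    s.length < κ.ord ∧ ∃ f ∈ B.lev n Z s.length, s = toSeq s.length f := by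
  obtain ⟨α, hα, f, hf, rfl⟩ := hs
  exact ⟨hα, f, hf, rfl⟩

/-- Nothing is omitted at successor levels: the only constraint on the new value is the bound. -/
theorem update_mem_lev {α i : Ordinal.{u}} {f : Fn.{u}} (hf : f ∈ B.lev n Z α)
    (hi : i < max B.lam.ord α) : Function.update f α i ∈ B.lev n Z (Order.succ α) := by
  refine mem_lev.2 ⟨fun ζ hζ => ?_, fun ζ hζ => ?_, fun β hβ => ?_, fun hl => ?_⟩
  · have := (Order.lt_succ α).trans_le hζ
    rw [Function.update_of_ne this.ne']
    exact supp_of_mem_lev hf this.le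
  · rcases (Order.lt_succ_iff.1 hζ).eq_or_lt with rfl | hζ
    · rwa [Function.update_self]
    · rw [Function.update_of_ne hζ.ne]
      exact (mem_lev.1 hf).2.1 ζ hζ
  · have hβ := Order.lt_succ_iff.1 hβ
    have : restr (Function.update f α i) β = restr f β :=
      restr_congr fun ζ hζ => Function.update_of_ne (hζ.trans_le hβ).ne _ _
    rw [this]
    exact restr_mem_lev hf hβ
  · exact absurd (hl.isSuccPrelimit) (Order.not_isSuccPrelimit_succ _)

namespace IsGood

theorem lev_nonempty (hB : B.IsGood κ) {α : Ordinal.{u}} (hα : α < κ.ord) :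
    (B.lev n Z α).Nonempty := by
  have h0 : (fun _ => 0 : Fn.{u}) ∈ B.lev n Z 0 :=
    mem_lev.2 ⟨fun _ _ => rfl, fun ζ hζ => absurd hζ not_lt_zero,
      fun ζ hζ => absurd hζ not_lt_zero, fun hl => absurd hl.bot_lt not_lt_zero⟩
  rcases eq_or_ne α 0 with rfl | h
  · exact ⟨_, h0⟩
  · exact ⟨_, hB.ext_mem hα (pos_iff_ne_zero.2 h) h0⟩

theorem isStreamlined (hB : B.IsGood κ) : IsStreamlined κ (B.seqTree κ n Z) where
  subset := by
    rintro _ ⟨α, hα, f, hf, rfl⟩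
    refine ⟨hα, fun i => ⟨(f i.1).toZFSet, (ZFSet.isOrdinal_toZFSet _).isTransitive,
      fun _ h => h, ?_⟩⟩
    rw [Ordinal.card_toZFSet, ← Cardinal.lt_ord]
    exact ((mem_lev.1 hf).2.1 i.1 i.2).trans (max_lt hB.lam_ord_lt (lt_trans i.2 hα))
  restrict_mem := by
    rintro _ ⟨α, hα, f, hf, rfl⟩ β hβ
    rcases le_total β α with h | h
    · exact ⟨β, hβ, _, restr_mem_lev hf h, toSeq_restrict f h⟩
    · refine ⟨α, hα, f, hf, ?_⟩
      exact OrdSeq.ext_of_val (min_eq_left h) fun _ _ _ => rfl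
  level_nonempty α hα := by
    obtain ⟨f, hf⟩ := hB.lev_nonempty (n := n) (Z := Z) hα
    exact ⟨_, ⟨α, hα, f, hf, rfl⟩, rfl⟩
  level_card α hα := by
    have hsub : seqLevel (B.seqTree κ n Z) α ⊆ toSeq α '' B.lev n Z α := by
      rintro _ ⟨⟨β, hβ, f, hf, rfl⟩, rfl⟩
      exact ⟨f, hf, rfl⟩
    exact ((Cardinal.mk_le_mk_of_subset hsub).trans (Cardinal.mk_image_le.trans
      (hB.mk_lev_le hα))).trans_lt (Cardinal.lift_lt.2 hB.lam_lt)

theorem isNormalTree (hB : B.IsGood κ) : IsNormalTree (B.seqTree κ n Z) κ := by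
  intro α β hαβ hβ x hx
  have hT := hB.isStreamlined (n := n) (Z := Z)
  have hl := (hT.hasHeight_iff _ _).1 hx
  obtain ⟨-, f, hf, he⟩ := exists_of_mem_seqTree x.2
  rw [hl] at hf he
  refine ⟨⟨_, β, hβ, _, hB.ext_mem hβ hαβ hf, rfl⟩, (hT.hasHeight_iff _ _).2 rfl, ?_⟩
  have hle : x.1 ≤ toSeq β (B.ext n Z β α f) := by
    rw [he]
    exact (toSeq_le fun _ => supp_of_mem_lev hf).2 ⟨hαβ.le, hB.restr_ext hβ hαβ hf⟩
  refine lt_of_le_of_ne hle fun h => ?_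
  have := congrArg (fun y : B.seqTree κ n Z => y.1.length) h
  exact hαβ.ne (hl.symm.trans this)

theorem isProlific (hB : B.IsGood κ) : IsProlific κ (B.seqTree κ n Z) := by
  rintro α hα _ ⟨⟨β, hβ, f, hf, rfl⟩, rfl⟩ i hi
  refine ⟨Order.succ β, (Cardinal.isSuccLimit_ord hB.regular.1).succ_lt hβ, _,
    update_mem_lev hf (hi.trans_le (max_le_max_right _ ?_)), toSeq_concat β f i⟩
  rw [← Cardinal.ord_aleph0]
  exact Cardinal.ord_le_ord.2 hB.lam_unc.le

/-- The function given by a branch. -/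
theorem exists_of_isBranch (hB : B.IsGood κ) {α : Ordinal.{u}} {b : Set (B.seqTree κ n Z)} (hb : IsBranch α b) :
    ∃ f : Fn.{u}, (∀ ζ, α ≤ ζ → f ζ = 0) ∧ (∀ β < α, restr f β ∈ B.lev n Z β) ∧
      ∀ x, x ∈ b ↔ ∃ β < α, x.1 = toSeq β (restr f β) := by
  have hT := hB.isStreamlined (n := n) (Z := Z)
  have hcomp : ∀ x ∈ b, ∀ y ∈ b, x.1.length ≤ y.1.length → x ≤ y := by
    intro x hx y hy hxy
    rcases hb.1.total hx hy with h | h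
    · exact h
    · exact (OrdSeq.eq_of_le_of_length_eq (s := y.1) h (le_antisymm h.1 hxy)).symm.le
  have hex : ∀ β : Ordinal.{u}, ∃ g : Fn.{u}, β < α → g ∈ B.lev n Z β ∧
      ∃ x ∈ b, x.1 = toSeq β g := by
    intro β
    by_cases hβ : β < α
    · obtain ⟨x, hx, hh⟩ := hb.2.2 β hβ
      obtain ⟨-, g, hg, he⟩ := exists_of_mem_seqTree x.2
      rw [(hT.hasHeight_iff _ _).1 hh] at hg he
      exact ⟨g, fun _ => ⟨hg, x, hx, he⟩⟩
    · exact ⟨fun _ => 0, fun h => absurd h hβ⟩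
  choose g hg using hex
  have hgr : ∀ γ < α, ∀ β ≤ γ, restr (g γ) β = g β := by
    intro γ hγ β hβγ
    obtain ⟨h1, x, hx, hxe⟩ := hg γ hγ
    obtain ⟨h2, y, hy, hye⟩ := hg β (hβγ.trans_lt hγ)
    have := hcomp y hy x hx (by rw [hxe, hye]; exact hβγ)
    have : y.1 ≤ x.1 := this
    rw [hxe, hye] at this
    exact ((toSeq_le fun _ => supp_of_mem_lev h2).1 this).2
  -- The value at `ζ` is read from the node of height `ζ + 1`, the first one defined there.
  have hr : ∀ β < α, restr (fun ζ => open Classical in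
      if ζ < α then g (Order.succ ζ) ζ else 0) β = g β := by
    intro β hβ
    rw [← hgr β hβ β le_rfl]
    refine restr_congr fun ζ hζ => ?_
    rw [if_pos (hζ.trans hβ), ← hgr β hβ _ (Order.succ_le_of_lt hζ),
      restr_of_lt _ (Order.lt_succ ζ)]
  refine ⟨_, fun ζ hζ => if_neg hζ.not_gt, fun β hβ => by rw [hr β hβ]; exact (hg β hβ).1,
    fun x => ⟨fun hx => ?_, ?_⟩⟩
  · obtain ⟨β, hβ, hh⟩ := hb.2.1 x hx
    obtain ⟨-, y, hy, hye⟩ := hg β hβ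
    refine ⟨β, hβ, ?_⟩
    rw [hr β hβ, ← hye]
    have hlx := (hT.hasHeight_iff _ _).1 hh
    have hly : y.1.length = β := by rw [hye]; rfl
    exact congrArg _ (le_antisymm (hcomp x hx y hy (by rw [hlx, hly]))
      (hcomp y hy x hx (by rw [hlx, hly])))
  · rintro ⟨β, hβ, he⟩
    rw [hr β hβ] at he
    obtain ⟨-, y, hy, hye⟩ := hg β hβ
    rwa [Subtype.ext (he.trans hye.symm)]

theorem isFull (hB : B.IsGood κ) : IsFull (B.seqTree κ n Z) κ := by
  intro α hα hl b b' hb hv hb' hv'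
  have key : ∀ b : Set (B.seqTree κ n Z), IsVanishing b → ∀ f : Fn.{u},
      (∀ x, x ∈ b ↔ ∃ β < α, x.1 = toSeq β (restr f β)) → f ∉ B.lev n Z α := by
    intro b hv f hf hfm
    refine hv ⟨⟨toSeq α f, α, hα, f, hfm, rfl⟩, fun x hx => ?_⟩
    obtain ⟨β, hβ, he⟩ := (hf x).1 hx
    have : x.1 ≤ toSeq α f := by
      rw [he]
      exact (toSeq_le fun ζ hζ => restr_of_le f hζ).2 ⟨hβ.le, rfl⟩
    exact this
  obtain ⟨f, h1, h2, h3⟩ := hB.exists_of_isBranch hb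
  obtain ⟨g, h4, h5, h6⟩ := hB.exists_of_isBranch hb'
  have := hB.eq_of_notMem_lev hα hl h1 h4 h2 h5 (key b hv f h3) (key b' hv' g h6)
  subst this
  ext x
  rw [h3, h6]

/-! ### The Souslin property -/

theorem mk_antichain_lt (hB : B.IsGood κ)
    (hs : ∀ A : Ordinal.{u} → Set Fn.{u}, (∀ ε, A ε ⊆ B.lev n Z ε) → B.IsPredense κ n Z A →
      ∃ α < κ.ord, ∀ t ∈ B.lev n Z α, ∃ ε < α, restr t ε ∈ A ε)
    {A : Set (B.seqTree κ n Z)} (hA : IsAntichain (· ≤ ·) A) :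
    #A < Cardinal.lift.{u + 1} κ := by
  -- Adding all nodes incomparable with `A` gives a predense family without first enlarging `A` to a
  -- maximal antichain.
  let A' : Ordinal.{u} → Set Fn.{u} := fun ε => {w | w ∈ B.lev n Z ε ∧
    ((∃ a ∈ A, a.1 = toSeq ε w) ∨ ∀ a ∈ A, ¬ a.1 ≤ toSeq ε w ∧ ¬ toSeq ε w ≤ a.1)}
  have hpre : B.IsPredense κ n Z A' := by
    intro δ hδ w hw
    by_cases h1 : ∃ a ∈ A, a.1 ≤ toSeq δ w
    · obtain ⟨a, ha, hle⟩ := h1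
      obtain ⟨hlt, f, hf, he⟩ := exists_of_mem_seqTree a.2
      rw [he] at hle
      obtain ⟨h2, h3⟩ := (toSeq_le fun _ => supp_of_mem_lev hf).1 hle
      exact ⟨δ, hδ, le_rfl, w, hw, restr_eq_of_mem_lev hw, _, h2, by rw [h3]; exact hf,
        Or.inl ⟨a, ha, by rw [h3]; exact he⟩⟩
    by_cases h2 : ∃ a ∈ A, toSeq δ w ≤ a.1
    · obtain ⟨a, ha, hle⟩ := h2
      obtain ⟨hlt, f, hf, he⟩ := exists_of_mem_seqTree a.2
      rw [he] at hle
      obtain ⟨h2, h3⟩ := (toSeq_le fun _ => supp_of_mem_lev hw).1 hle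
      refine ⟨_, hlt, h2, f, hf, h3, _, le_rfl, ?_⟩
      rw [restr_eq_of_mem_lev hf]
      exact ⟨hf, Or.inl ⟨a, ha, he⟩⟩
    · push Not at h1 h2
      refine ⟨δ, hδ, le_rfl, w, hw, restr_eq_of_mem_lev hw, δ, le_rfl, ?_⟩
      rw [restr_eq_of_mem_lev hw]
      exact ⟨hw, Or.inr fun a ha => ⟨h1 a ha, h2 a ha⟩⟩
  -- An element of `A` of height at least `α` would properly extend an element of `A'`, which
  -- neither kind of element allows. So `A` lies below `α`.
  obtain ⟨α, hα, hseal⟩ := hs A' (fun ε w hw => hw.1) hpre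
  have hlen : ∀ a ∈ A, a.1.length < α := by
    intro a ha
    by_contra! hle
    obtain ⟨hlt, f, hf, he⟩ := exists_of_mem_seqTree a.2
    obtain ⟨ε, hε, hm, hor⟩ := hseal _ (restr_mem_lev hf hle)
    rw [restr_restr _ hε.le] at hm hor
    have hεa : toSeq ε (restr f ε) ≤ a.1 := by
      rw [he]
      exact (toSeq_le fun ζ hζ => restr_of_le f hζ).2 ⟨(hε.le.trans hle), rfl⟩
    rcases hor with ⟨a', ha', he'⟩ | h
    · rw [← he'] at hεa
      have hne : a' ≠ a := by
        rintro rfl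
        have : a'.1.length = ε := by rw [he']; rfl
        exact absurd this (hε.trans_le hle).ne'
      exact hA ha' ha hne hεa
    · exact (h a ha).2 hεa
  have hinf : ℵ₀ ≤ Cardinal.lift.{u + 1} B.lam := Cardinal.aleph0_le_lift.2 hB.lam_unc.le
  have hsub : Subtype.val '' A ⊆ ⋃ ε : Set.Iio α, toSeq ε.1 '' B.lev n Z ε.1 := by
    rintro _ ⟨a, ha, rfl⟩
    obtain ⟨-, f, hf, he⟩ := exists_of_mem_seqTree a.2
    exact Set.mem_iUnion.2 ⟨⟨_, hlen a ha⟩, f, hf, he.symm⟩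
  rw [← Cardinal.mk_image_eq (s := A) Subtype.val_injective]
  refine lt_of_le_of_lt ?_ (Cardinal.lift_lt.2 hB.lam_lt)
  refine (Cardinal.mk_le_mk_of_subset hsub).trans (Cardinal.mk_iUnion_le_sum_mk.trans ?_)
  refine (Cardinal.sum_le_sum _ (fun _ => Cardinal.lift.{u + 1} B.lam)
    fun (ε : Set.Iio α) => Cardinal.mk_image_le.trans (hB.mk_lev_le (ε.2.trans hα))).trans ?_
  rw [Cardinal.sum_const']
  exact Cardinal.mul_le_of_le hinf (hB.mk_Iio_le hα) le_rfl

/-- Leaving a `κ`-branch at every height by a wrong value gives `κ` many pairwise incomparable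
nodes. -/
theorem not_isBranch (hB : B.IsGood κ)
    (hanti : ∀ A : Set (B.seqTree κ n Z), IsAntichain (· ≤ ·) A →
      #A < Cardinal.lift.{u + 1} κ) (b : Set (B.seqTree κ n Z)) : ¬ IsBranch κ.ord b := by
  classical
  intro hb
  have hκl := Cardinal.isSuccLimit_ord hB.regular.1
  obtain ⟨f, -, hf, -⟩ := hB.exists_of_isBranch hb
  let i : Ordinal.{u} → Ordinal.{u} := fun β => if f β = 0 then 1 else 0
  have hi : ∀ β, i β ≠ f β := by
    intro β h
    by_cases h0 : f β = 0
    · simp [i, h0] at h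
    · exact h0 (by simpa [i, h0] using h.symm)
  have hone : (1 : Ordinal.{u}) < B.lam.ord := by
    refine Ordinal.one_lt_omega0.trans ?_
    rw [← Cardinal.ord_aleph0]; exact Cardinal.ord_lt_ord.2 hB.lam_unc
  have hi' : ∀ β, i β < max B.lam.ord β := by
    intro β
    refine lt_max_of_lt_left ?_
    by_cases h0 : f β = 0
    · simpa [i, h0] using hone
    · simpa [i, h0] using hB.lam_regular.ord_pos
  let y : Set.Iio κ.ord → B.seqTree κ n Z := fun β =>
    ⟨_, _, hκl.succ_lt β.2, _, update_mem_lev (hf β.1 β.2) (hi' β.1), rfl⟩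
  have hle : ∀ β γ, y β ≤ y γ → β = γ := by
    intro β γ h
    have h : toSeq (Order.succ β.1) (Function.update (restr f β.1) β.1 (i β.1)) ≤
      toSeq (Order.succ γ.1) (Function.update (restr f γ.1) γ.1 (i γ.1)) := h
    obtain ⟨h1, h2⟩ := (toSeq_le fun _ =>
      supp_of_mem_lev (update_mem_lev (hf β.1 β.2) (hi' β.1))).1 h
    rcases (Order.succ_le_succ_iff.1 h1).eq_or_lt with h3 | h3
    · exact Subtype.ext h3
    · have := congrFun h2 β.1
      rw [Function.update_self, restr_of_lt _ (Order.lt_succ _), Function.update_of_ne h3.ne,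
        restr_of_lt _ h3] at this
      exact absurd this.symm (hi β.1)
  have hA : IsAntichain (· ≤ ·) (Set.range y) := by
    rintro _ ⟨β, rfl⟩ _ ⟨γ, rfl⟩ hne h
    exact hne (congrArg y (hle β γ h))
  have hlt := hanti _ hA
  rw [Cardinal.mk_range_eq y fun β γ h => hle β γ h.le, Cardinal.mk_Iio_ordinal,
    Cardinal.card_ord] at hlt
  exact lt_irrefl _ hlt

theorem isSouslinTree (hB : B.IsGood κ)
    (hs : ∀ A : Ordinal.{u} → Set Fn.{u}, (∀ ε, A ε ⊆ B.lev n Z ε) → B.IsPredense κ n Z A →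
      ∃ α < κ.ord, ∀ t ∈ B.lev n Z α, ∃ ε < α, restr t ε ∈ A ε) :
    IsSouslinTree (B.seqTree κ n Z) κ where
  isKTree := hB.isStreamlined.isKTree
  no_branch := fun ⟨b, hb⟩ => hB.not_isBranch (fun _ hA => hB.mk_antichain_lt hs hA) b hb
  no_antichain := by
    rintro ⟨A, hA, hc⟩
    rw [Cardinal.lift_id'.{u, u + 1}] at hc
    exact absurd hc (hB.mk_antichain_lt hs hA).ne

end IsGood
end Blueprint

/-! ### Diamond -/

open Classical in
/-- A diamond sequence, extended to all ordinals. -/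
def extendDiamond {lam : Cardinal.{u}}
    (F : (β : Set.Iio lam.ord) → Set.Iio β → Set.Iio lam.ord) (β ξ : Ordinal.{u}) : Ordinal.{u} :=
  if h : ∃ _ : β < lam.ord, ∃ _ : ξ < lam.ord, ξ < β then
    (F ⟨β, h.1⟩ ⟨⟨ξ, h.2.1⟩, h.2.2⟩).1 else 0

theorem isClub_closed {lam : Cardinal.{u}} (hl : lam.IsRegular) (hu : ℵ₀ < lam)
    (h : Ordinal.{u} → Ordinal.{u}) (hh : ∀ ξ < lam.ord, h ξ < lam.ord) :
    IsClub {β : Set.Iio lam.ord | Order.IsSuccLimit β.1 ∧ ∀ ξ < β.1, h ξ < β.1} := by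
  constructor
  · intro d hd hne _ a ha
    have hlt : ∀ γ < a.1, ∃ β ∈ d, γ < β.1 := by
      intro γ hγ
      by_contra! hcon
      have : a ≤ ⟨γ, lt_trans hγ a.2⟩ := ha.2 fun β hβ => hcon β hβ
      exact absurd hγ (not_lt.2 this)
    refine ⟨⟨fun hm => ?_, Order.isSuccPrelimit_of_succ_lt fun γ hγ => ?_⟩, fun ξ hξ => ?_⟩
    · obtain ⟨β, hβ⟩ := hne
      have h1 := (hd hβ).1.bot_lt
      have h2 : β.1 ≤ a.1 := ha.1 hβ
      exact absurd (h1.trans_le h2) (by rw [hm.eq_bot]; exact lt_irrefl _)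
    · obtain ⟨β, hβ, hγβ⟩ := hlt γ hγ
      have h2 : β.1 ≤ a.1 := ha.1 hβ
      exact ((hd hβ).1.succ_lt hγβ).trans_le h2
    · obtain ⟨β, hβ, hξβ⟩ := hlt ξ hξ
      have h2 : β.1 ≤ a.1 := ha.1 hβ
      exact ((hd hβ).2 ξ hξβ).trans_le h2
  · intro a
    obtain ⟨δ, hδ, hδl, -, hcl⟩ := exists_closed_omega hl hu (fun ξ => max (h ξ) a.1)
      fun ξ hξ => max_lt (hh ξ hξ) a.2
    refine ⟨⟨δ, hδ⟩, ⟨hδl, fun ξ hξ => (le_max_left _ _).trans_lt (hcl ξ hξ)⟩, ?_⟩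
    exact ((le_max_right _ _).trans_lt (hcl 0 hδl.bot_lt)).le

/-- The limit ordinals closed under `h` form a club, which meets the stationary set of correct
guesses. -/
theorem Diamond.exists_guess {lam : Cardinal.{u}} (hl : lam.IsRegular) (hu : ℵ₀ < lam)
    (hd : Diamond lam) : ∃ F : Ordinal.{u} → Ordinal.{u} → Ordinal.{u},
      ∀ f : Ordinal.{u} → Ordinal.{u}, (∀ ξ < lam.ord, f ξ < lam.ord) →
        ∀ h : Ordinal.{u} → Ordinal.{u}, (∀ ξ < lam.ord, h ξ < lam.ord) →
          ∃ β < lam.ord, Order.IsSuccLimit β ∧ (∀ ξ < β, h ξ < β) ∧ ∀ ξ < β, f ξ = F β ξ := by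
  obtain ⟨F, hF⟩ := hd
  refine ⟨extendDiamond F, fun f hf h hh => ?_⟩
  obtain ⟨β, h1, h2, h3⟩ := hF (fun ξ => ⟨f ξ.1, hf ξ.1 ξ.2⟩) (isClub_closed hl hu h hh)
  refine ⟨β.1, β.2, h2, h3, fun ξ hξ => ?_⟩
  have h4 := h1 ⟨⟨ξ, lt_trans hξ β.2⟩, hξ⟩
  have h5 : ∃ _ : β.1 < lam.ord, ∃ _ : ξ < lam.ord, ξ < β.1 := ⟨β.2, lt_trans hξ β.2, hξ⟩
  rw [extendDiamond, dif_pos h5, ← h4]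

end FullSouslin

end

theorem mainTheorem7 (κ lam : Cardinal.{u})
    (hreg : lam.IsRegular) (hunc : Cardinal.aleph0 < lam)
    (hsucc : κ = Order.succ lam) (hpow : κ = 2 ^ lam)
    (hsquare : FullSouslin.Square lam) (hdiamond : FullSouslin.Diamond lam) :
    ∃ T : Set FullSouslin.OrdSeq.{u},
      FullSouslin.IsStreamlined κ T ∧ FullSouslin.IsNormalTree T κ ∧
        FullSouslin.IsProlific κ T ∧ FullSouslin.IsFull T κ ∧
          FullSouslin.IsSouslinTree T κ := by
  obtain ⟨S, D, hL⟩ := FullSouslin.exists_isLadder hreg hunc hsucc hsquare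
  obtain ⟨F, hF⟩ := hdiamond.exists_guess hreg hunc
  have hB : FullSouslin.Blueprint.IsGood ⟨lam, S, D, F⟩ κ := ⟨hreg, hunc, hsucc, hL, hF⟩
  obtain ⟨n, Z, hs⟩ := hB.exists_sealed hpow
  exact ⟨_, hB.isStreamlined, hB.isNormalTree, hB.isProlific, hB.isFull, hB.isSouslinTree hs⟩
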